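/- **Common syntax and reduction.** Both calculi extend the untyped call-by-push-value language MAM; terms are taken up to $\alpha$-equivalence. Values: $V ::= x \mid () \mid l \mid (V,W) \mid \mathbf{inj}_L V \mid \{M\}$, with $l$ a label from a countably infinite set. Computations: $M ::= \mathbf{case}\,V\,\mathbf{of}\,(x_1,x_2)\mapsto M \mid \mathbf{case}\,V\,\mathbf{of}\,\{\mathbf{inj}_{L_i}x_i\mapsto M_i\}_i \mid V! \mid \mathbf{return}\,V \mid x\leftarrow M;N \mid \lambda x.M \mid M\,V \mid \langle M,N\rangle \mid \mathbf{prj}_i M$ (we also write $\mathbf{let}\,x=M\,\mathbf{in}\,N$ for $x\leftarrow M;N$). A store $\theta$ is a finite partial map from labels to stored objects or $\mathbf{nil}$; a configuration is $\bot$ or a pair $\langle M,\theta\rangle$. The common $\beta$-steps, which do not change the store, are the usual ones: $\mathbf{case}\,(V_1,V_2)\,\mathbf{of}\,(x_1,x_2)\mapsto M \to M[V_1/x_1,V_2/x_2]$; $\mathbf{case}\,\mathbf{inj}_{L_j}V\,\mathbf{of}\,\{\dots\}\to M_j[V/x_j]$; $\{M\}!\to M$; $x\leftarrow\mathbf{return}\,V;M\to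 M[V/x]$; $(\lambda x.M)\,V\to M[V/x]$; $\mathbf{prj}_i\langle M_1,M_2\rangle\to M_i$. Pure contexts: $H ::= [\,] \mid x\leftarrow H;N \mid H\,V\mid \mathbf{prj}_i H$. A label is fresh if it is not in the domain of the store. **$\mathrm{DEL}_{one}$** adds the computations $\mathbf{shift}\,k.M$, the dollar term $\langle M\mid x.N\rangle$ and $\mathbf{throw}\,V\,W$. Evaluation contexts $C$ are built like pure contexts, with the additional frame $\langle C\mid x.N\rangle$. Stored objects are captured continuations $\lambda y.\langle H[\mathbf{return}\,y]\mid x.M\rangle$ with $y$ not free in $H,M$. Additional $\beta$-steps: - (ret) $\langle\,\langle \mathbf{return}\,V\mid x.M\rangle,\theta\rangle\to\langle M[V/x],\theta\rangle$; - (shift) $\langle\,\langle H[\mathbf{shift}\,k.M]\mid x.N\rangle,\theta\rangle\to\langle M[l/k],\theta[l:=\lambda y.\langle H[\mathbf{return}\,y]\mid x.N\rangle]\rangle$ with $l$ fresh; - (throw) if $\theta(l)=\lambda y.\langle H[\mathbf{return}\,y]\mid x.N\rangle$, then $\langle\mathbf{throw}\,l\,V,\theta\rangle\to\langle\,\langle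 H[\mathbf{return}\,V]\mid x.N\rangle,\theta[l:=\mathbf{nil}]\rangle$; - (fail) if $\theta(l)=\mathbf{nil}$, then $\langle\mathbf{throw}\,l\,V,\theta\rangle\to\bot$. **$\mathrm{AC}$** (asymmetric coroutines) adds $\mathbf{create}\,V$, $\mathbf{resume}\,V\,W$, $\mathbf{yield}\,V$ and labelled computations $l:M$. Evaluation contexts $D$ have the additional frame $l:D$; stored objects are values. Additional $\beta$-steps: - (create) $\langle\mathbf{create}\,V,\tau\rangle\to\langle\mathbf{return}\,l,\tau[l:=V]\rangle$ with $l$ fresh; - (resume) if $\tau(l)=V$ is a value, $\langle\mathbf{resume}\,l\,W,\tau\rangle\to\langle l:(V!\,W),\tau[l:=\mathbf{nil}]\rangle$; - (fail) if $\tau(l)=\mathbf{nil}$, $\langle\mathbf{resume}\,l\,W,\tau\rangle\to\bot$; - (ret) $\langle l:\mathbf{return}\,V,\tau\rangle\to\langle\mathbf{return}\,V,\tau\rangle$; - (yield) $\langle l:H[\mathbf{yield}\,V],\tau\rangle\to\langle\mathbf{return}\,V,\tau[l:=\{\lambda y.H[\mathbf{return}\,y]\}]\rangle$. The reduction $\to_{AC}$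 is the closure of these steps under evaluation contexts, where a step to $\bot$ inside any context is a step to $\bot$; $\to_{AC}^{+}$ is its transitive closure. The set $\mathrm{AL}(E)$ of active labels consists of all $l$ such that some $l:M$ occurs in $E$. The predicate $\mathrm{WF}(M)$ is defined inductively: $x\leftarrow M;N$, $M\,V$ and $\mathbf{prj}_iM$ are WF if $M$ is WF and $N$, respectively $V$, has no active labels; $l:M$ is WF if $M$ is WF and $l\notin\mathrm{AL}(M)$; every other computation is WF if it has no active labels. A configuration $\langle M,\tau\rangle$ is *well-formed* if $\mathrm{WF}(M)$, no value stored in $\tau$ has active labels, and $\tau(l)=\mathbf{nil}$ for all $l\in\mathrm{AL}(M)$. **Auxiliary $\mathrm{AC}$-programs.** Numbers are written in unary: $0=\mathbf{inj}_{Zero}()$, $n+1=\mathbf{inj}_{Succ}\,n$. Let $\mathit{incr}=\{\lambda n.\mathbf{return}\,\mathbf{inj}_{Succ}n\}$, and let $\mathit{compare}$ be the equality test of numerals with results $\mathbf{inj}_{True}()$ and $\mathbf{inj}_{False}()$, defined by self-application: $\mathit{compare}=\{q!\,q\}$ with $$q=\{\lambda f.\lambda a.\lambda b.\,\mathbf{case}\,a\,\mathbf{of}\,\{\mathbf{inj}_{Zero}\_\mapsto\mathbf{case}\,b\,\mathbf{of}\,\{\mathbf{inj}_{Zero}\_\mapsto\mathbf{return}\,\mathbf{inj}_{True}();\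 \mathbf{inj}_{Succ}\_\mapsto\mathbf{return}\,\mathbf{inj}_{False}()\};\ \mathbf{inj}_{Succ}a'\mapsto\mathbf{case}\,b\,\mathbf{of}\,\{\mathbf{inj}_{Zero}\_\mapsto\mathbf{return}\,\mathbf{inj}_{False}();\ \mathbf{inj}_{Succ}b'\mapsto f!\,f\,a'\,b'\}\}\}.$$ Reference cells are coroutines: with $$s=\{\lambda f.\lambda v.\lambda c.\,\mathbf{case}\,c\,\mathbf{of}\,\{\mathbf{inj}_{Get}\_\mapsto c'\leftarrow\mathbf{yield}\,v;\,f!\,f\,v\,c';\ \mathbf{inj}_{Set}w\mapsto c'\leftarrow\mathbf{yield}\,();\,f!\,f\,w\,c'\}\}$$ let $\mathrm{refcell}(V)=\{\lambda y.\,c\leftarrow\mathbf{return}\,y;\,s!\,s\,V\,c\}$, $\mathit{ref}=\{\lambda v.\mathbf{create}\,\mathrm{refcell}(v)\}$, $\mathit{get}=\{\lambda r.\mathbf{resume}\,r\,(\mathbf{inj}_{Get}())\}$, $\mathit{set}=\{\lambda r.\lambda v.\mathbf{resume}\,r\,(\mathbf{inj}_{Set}v)\}$. Let $\mathit{fail}=\{z\leftarrow\mathbf{create}\,\{\lambda\_.\mathbf{return}\,()\};\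 \_\leftarrow\mathbf{resume}\,z\,();\ \mathbf{resume}\,z\,()\}$. We write $\mathrm{getnum}(l,\tau)=i$ if $\tau(l)=\mathrm{refcell}(i)$. **Macro-translation.** Let $\eta$ be a partial function from $\mathrm{DEL}_{one}$-labels to triples $(z,zc,i)$ of two $\mathrm{AC}$-labels and a natural number. The translation $[\![E]\!]_\eta$ of expressions and pure contexts is defined if all labels of $E$ are in $\mathrm{dom}\,\eta$. It commutes with all constructs of MAM, and - $[\![l]\!]_\eta=((z,zc),i)$ if $\eta(l)=(z,zc,i)$; - $[\![\mathbf{shift}\,k.M]\!]_\eta=\mathbf{yield}\,\{\lambda k.[\![M]\!]_\eta\}$; - $[\![\langle M\mid x.N\rangle]\!]_\eta=\mathbf{let}\,z=\mathbf{create}\,\{\lambda\_.\,x\leftarrow[\![M]\!]_\eta;\mathbf{return}\,\{\lambda\_.[\![N]\!]_\eta\}\}\,\mathbf{in}\ \mathbf{let}\,zc=\mathit{ref}!\,0\,\mathbf{in}\ \mathbf{let}\,res=\mathbf{resume}\,z\,()\,\mathbf{in}\ res!\,((z,zc),0)$; - $[\![\mathbf{throw}\,V\,W]\!]_\eta=\mathbf{case}\,[\![V]\!]_\eta\,\mathbf{of}\,((z,zc),i)\mapsto\mathbf{let}\,j=\mathit{get}!\,zc\,\mathbf{in}\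 \mathbf{let}\,b=\mathit{compare}!\,i\,j\,\mathbf{in}\ \mathbf{case}\,b\,\mathbf{of}\,\{\mathbf{inj}_{True}\_\mapsto\mathbf{let}\,i'=\mathit{incr}!\,i\,\mathbf{in}\ \mathbf{let}\,\_=\mathit{set}!\,zc\,i'\,\mathbf{in}\ \mathbf{let}\,res=\mathbf{resume}\,z\,[\![W]\!]_\eta\,\mathbf{in}\ res!\,((z,zc),i');\ \mathbf{inj}_{False}\_\mapsto\mathit{fail}!\}$, where a nested pair pattern is matched one level after the other and all bound variables other than those of the source are chosen fresh. **The relation $\sim_{\eta,\kappa}$.** Let also $\kappa$ be a partial function from $\mathrm{AC}$-labels to $\mathrm{AC}$-labels. The relation $\langle M,\theta\rangle\sim_{\eta,\kappa}\langle N,\tau\rangle$ is defined inductively; all translations that occur are required to be defined: 1. $\langle M,\theta\rangle\sim_{\eta,\kappa}\langle[\![M]\!]_\eta,\tau\rangle$ if $M$ is a pair case, a variant case, $V!$, $\mathbf{return}\,V$, $\lambda x.M'$, $\langle M_1,M_2\rangle$, a $\mathbf{shift}$, a dollar term, or a $\mathbf{throw}$; 2. if $\langle M,\theta\rangle\sim_{\eta,\kappa}\langle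 N,\tau\rangle$, then $\langle x\leftarrow M;M_2,\theta\rangle\sim_{\eta,\kappa}\langle x\leftarrow N;[\![M_2]\!]_\eta,\tau\rangle$, $\langle M\,V,\theta\rangle\sim_{\eta,\kappa}\langle N\,[\![V]\!]_\eta,\tau\rangle$ and $\langle\mathbf{prj}_iM,\theta\rangle\sim_{\eta,\kappa}\langle\mathbf{prj}_iN,\tau\rangle$; 3. if $\langle M_1,\theta\rangle\sim_{\eta,\kappa}\langle N_1,\tau\rangle$, $\mathrm{getnum}(\kappa(m),\tau)=i$, $\tau(m)=\mathbf{nil}$, and $\theta(l)=\mathbf{nil}$ for every $l$ with $\eta(l)=(m,\kappa(m),j)$ for some $j$, then $\langle\,\langle M_1\mid x.M_2\rangle,\theta\rangle\sim_{\eta,\kappa}\langle\,\mathbf{let}\,res=m:(x\leftarrow N_1;\mathbf{return}\,\{\lambda\_.[\![M_2]\!]_\eta\})\,\mathbf{in}\ res!\,((m,\kappa(m)),i),\ \tau\rangle$. **The simulation relation.** For configurations $C$ of $\mathrm{DEL}_{one}$ and $D$ of $\mathrm{AC}$, $C\sim D$ means that $C=D=\bot$, or that $C=\langle M,\theta\rangle$,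 $D=\langle N,\tau\rangle$, $D$ is well-formed, and for some $\eta,\kappa$ as above $C\sim_{\eta,\kappa}D$ and the following invariant conditions hold: - $\kappa$ is injective, $\mathrm{dom}\,\kappa\cap\mathrm{im}\,\kappa=\emptyset$, $\mathrm{dom}\,\kappa\cup\mathrm{im}\,\kappa=\mathrm{dom}\,\tau$, and $\mathrm{dom}\,\eta=\mathrm{dom}\,\theta$; - if $\eta(l)=(z,zc,i)$, then $\kappa(z)=zc$; - if $\eta(l)=(z,zc,i)$ and $\theta(l)=\mathbf{nil}$, then $\mathrm{getnum}(zc,\tau)>i$; - if $\eta(l)=(z,zc,i)$ and $\theta(l)=\lambda y.\langle H[\mathbf{return}\,y]\mid x.M'\rangle$, then $l$ does not occur in $M'$; $\mathrm{getnum}(zc,\tau)=i$; $\theta(l')=\mathbf{nil}$ for every $l'\in\mathrm{dom}\,\theta$ with $l'\neq l$ for which the first component of $\eta(l')$ is $z$; and $\tau(z)=\{\lambda y.\,x\leftarrow[\![H]\!]_\eta[\mathbf{return}\,y];\mathbf{return}\,\{\lambda\_.[\![M']\!]_\eta\}\}$. **Theorem.** Let $C$ be an evaluation context of $\mathrm{DEL}_{one}$,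 $M$ a computation and $\theta$ a store of $\mathrm{DEL}_{one}$, and $D$ a configuration of $\mathrm{AC}$ such that $\langle C[M],\theta\rangle\sim D$. - If $\langle M,\theta\rangle$ takes a $\beta$-step to $\langle M',\theta'\rangle$, then there is a configuration $D'$ with $D\to_{AC}^{+}D'$ and $\langle C[M'],\theta'\rangle\sim D'$. - If $\langle M,\theta\rangle$ takes a $\beta$-step to $\bot$, then there is a configuration $D'$ with $D\to_{AC}^{+}D'$ and $\bot\sim D'$, that is, $D\to_{AC}^{+}\bot$. -/

import Mathlib

namespace DelToAC

/-! ### Common material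

Both calculi extend the multi-adjunctive metalanguage MAM (call-by-push-value without types).
Terms are represented with de Bruijn indices, so that equality of terms is
`α`-equivalence and substitution is capture avoiding. -/

/-- Continuation labels of `DEL_one` and coroutine labels of `AC`. -/
abbrev Label := ℕ

/-- Variant (sum constructor) labels. -/
abbrev Tag := ℕ

/-- The action of a renaming below one binder. -/
def liftR (ρ : ℕ → ℕ) : ℕ → ℕ
  | 0 => 0
  | n + 1 => ρ n + 1

/-- The assignment sending index `0` to `a` and index `n + 1` to `σ n`. -/
def scons {α : Type} (a : α) (σ : ℕ → α) : ℕ → α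
  | 0 => a
  | n + 1 => σ n

/-- The content of a store location: either `nil` or a stored object. -/
inductive Slot (α : Type) : Type
  | nil : Slot α
  | full : α → Slot α

/-- Domain of a partial function. -/
def pdom {α β : Type} (f : α → Option β) : Set α := {a | ∃ b, f a = some b}

/-- Image of a partial function. -/
def pim {α β : Type} (f : α → Option β) : Set β := {b | ∃ a, f a = some b}

/-! ### The calculus `DEL_one` -/

mutual
/-- Values of `DEL_one`. -/
inductive DVal : Type
  | var : ℕ → DVal
  | unit : DVal
  | lab : Label → DVal
  | pair : DVal → DVal → DVal
  | inj : Tag → DVal → DVal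
  | thunk : DComp → DVal
/-- Computations of `DEL_one`.
* `pcase V M` is `case V of (x₁, x₂) ↦ M`; in `M` index `1` is `x₁` and index `0` is `x₂`.
* `scase V B` is `case V of {inj_{L_i} x_i ↦ M_i}_i`; each `M_i` binds `x_i` as index `0`.
* `seq M N` is `x ← M; N` (also written `let x = M in N`); `N` binds `x`.
* `lam M` is `λx. M`; `cpair M N` is `⟨M, N⟩`.
* `shift M` is `shift k. M`; `M` binds `k`.
* `dollar M N` is the delimited computation `⟨M | x. N⟩`; `N` binds `x`.
* `throw V W` passes `W` to the continuation `V`. -/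
inductive DComp : Type
  | pcase : DVal → DComp → DComp
  | scase : DVal → DBrs → DComp
  | force : DVal → DComp
  | ret : DVal → DComp
  | seq : DComp → DComp → DComp
  | lam : DComp → DComp
  | app : DComp → DVal → DComp
  | cpair : DComp → DComp → DComp
  | prj : Fin 2 → DComp → DComp
  | shift : DComp → DComp
  | dollar : DComp → DComp → DComp
  | throw : DVal → DVal → DComp
/-- Finite families of branches `inj_{L_i} x_i ↦ M_i`. -/
inductive DBrs : Type
  | nil : DBrs
  | cons : Tag → DComp → DBrs → DBrs
end

mutual
/-- Renaming of variables. -/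
def DVal.ren (ρ : ℕ → ℕ) : DVal → DVal
  | .var n => .var (ρ n)
  | .unit => .unit
  | .lab l => .lab l
  | .pair V W => .pair (V.ren ρ) (W.ren ρ)
  | .inj L V => .inj L (V.ren ρ)
  | .thunk M => .thunk (M.ren ρ)
def DComp.ren (ρ : ℕ → ℕ) : DComp → DComp
  | .pcase V M => .pcase (V.ren ρ) (M.ren (liftR (liftR ρ)))
  | .scase V B => .scase (V.ren ρ) (B.ren ρ)
  | .force V => .force (V.ren ρ)
  | .ret V => .ret (V.ren ρ)
  | .seq M N => .seq (M.ren ρ) (N.ren (liftR ρ))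
  | .lam M => .lam (M.ren (liftR ρ))
  | .app M V => .app (M.ren ρ) (V.ren ρ)
  | .cpair M N => .cpair (M.ren ρ) (N.ren ρ)
  | .prj i M => .prj i (M.ren ρ)
  | .shift M => .shift (M.ren (liftR ρ))
  | .dollar M N => .dollar (M.ren ρ) (N.ren (liftR ρ))
  | .throw V W => .throw (V.ren ρ) (W.ren ρ)
def DBrs.ren (ρ : ℕ → ℕ) : DBrs → DBrs
  | .nil => .nil
  | .cons L M B => .cons L (M.ren (liftR ρ)) (B.ren ρ)
end

/-- The action of a substitution below one binder. -/
def DVal.up (σ : ℕ → DVal) : ℕ → DVal :=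
  scons (.var 0) (fun n => (σ n).ren Nat.succ)

mutual
/-- Simultaneous substitution. -/
def DVal.sub (σ : ℕ → DVal) : DVal → DVal
  | .var n => σ n
  | .unit => .unit
  | .lab l => .lab l
  | .pair V W => .pair (V.sub σ) (W.sub σ)
  | .inj L V => .inj L (V.sub σ)
  | .thunk M => .thunk (M.sub σ)
def DComp.sub (σ : ℕ → DVal) : DComp → DComp
  | .pcase V M => .pcase (V.sub σ) (M.sub (DVal.up (DVal.up σ)))
  | .scase V B => .scase (V.sub σ) (B.sub σ)
  | .force V => .force (V.sub σ)
  | .ret V => .ret (V.sub σ)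
  | .seq M N => .seq (M.sub σ) (N.sub (DVal.up σ))
  | .lam M => .lam (M.sub (DVal.up σ))
  | .app M V => .app (M.sub σ) (V.sub σ)
  | .cpair M N => .cpair (M.sub σ) (N.sub σ)
  | .prj i M => .prj i (M.sub σ)
  | .shift M => .shift (M.sub (DVal.up σ))
  | .dollar M N => .dollar (M.sub σ) (N.sub (DVal.up σ))
  | .throw V W => .throw (V.sub σ) (W.sub σ)
def DBrs.sub (σ : ℕ → DVal) : DBrs → DBrs
  | .nil => .nil
  | .cons L M B => .cons L (M.sub (DVal.up σ)) (B.sub σ)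
end

/-- `M[V/x]`, where `x` is index `0`. -/
def DComp.inst (M : DComp) (V : DVal) : DComp := M.sub (scons V DVal.var)

/-- `M[V₁/x₁, V₂/x₂]`, where `x₁` is index `1` and `x₂` is index `0`. -/
def DComp.inst2 (M : DComp) (V₁ V₂ : DVal) : DComp :=
  M.sub (scons V₂ (scons V₁ DVal.var))

/-- The branch of a case distinction that belongs to a tag. -/
def DBrs.find (L : Tag) : DBrs → Option DComp
  | .nil => none
  | .cons L' M B => if L' = L then some M else B.find L

mutual
/-- The set of continuation labels that occur in an expression. -/
def DVal.labels : DVal → Set Label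
  | .var _ => ∅
  | .unit => ∅
  | .lab l => {l}
  | .pair V W => V.labels ∪ W.labels
  | .inj _ V => V.labels
  | .thunk M => M.labels
def DComp.labels : DComp → Set Label
  | .pcase V M => V.labels ∪ M.labels
  | .scase V B => V.labels ∪ B.labels
  | .force V => V.labels
  | .ret V => V.labels
  | .seq M N => M.labels ∪ N.labels
  | .lam M => M.labels
  | .app M V => M.labels ∪ V.labels
  | .cpair M N => M.labels ∪ N.labels
  | .prj _ M => M.labels
  | .shift M => M.labels
  | .dollar M N => M.labels ∪ N.labels
  | .throw V W => V.labels ∪ W.labels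
def DBrs.labels : DBrs → Set Label
  | .nil => ∅
  | .cons _ M B => M.labels ∪ B.labels
end

/-- Pure contexts `H` of `DEL_one`; `seq H N` is `x ← H[ ]; N`, and so on. -/
inductive DPCtx : Type
  | hole : DPCtx
  | seq : DPCtx → DComp → DPCtx
  | app : DPCtx → DVal → DPCtx
  | prj : Fin 2 → DPCtx → DPCtx

/-- `H[M]`. -/
def DPCtx.plug : DPCtx → DComp → DComp
  | .hole, M => M
  | .seq H N, M => .seq (H.plug M) N
  | .app H V, M => .app (H.plug M) V
  | .prj i H, M => .prj i (H.plug M)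

/-- The set of continuation labels that occur in a pure context. -/
def DPCtx.labels : DPCtx → Set Label
  | .hole => ∅
  | .seq H N => H.labels ∪ N.labels
  | .app H V => H.labels ∪ V.labels
  | .prj _ H => H.labels

/-- Evaluation contexts `C` of `DEL_one`; `dollar C N` is `⟨C[ ] | x. N⟩`. -/
inductive DCtx : Type
  | hole : DCtx
  | seq : DCtx → DComp → DCtx
  | app : DCtx → DVal → DCtx
  | prj : Fin 2 → DCtx → DCtx
  | dollar : DCtx → DComp → DCtx

/-- `C[M]`. -/
def DCtx.plug : DCtx → DComp → DComp
  | .hole, M => M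
  | .seq C N, M => .seq (C.plug M) N
  | .app C V, M => .app (C.plug M) V
  | .prj i C, M => .prj i (C.plug M)
  | .dollar C N, M => .dollar (C.plug M) N

/-- Captured continuations: `⟨H, M⟩` stands for the abstraction `λy. ⟨H[return y] | x. M⟩` with
`y` not free in `H` and `M`; in `body` the variable `x` is index `0`. -/
structure DCont : Type where
  ctx : DPCtx
  body : DComp

/-- Stores of `DEL_one`: finite partial maps from continuation labels to captured continuations
or `nil`. -/
abbrev DStore := Finmap (fun _ : Label => Slot DCont)

/-- Configurations of `DEL_one`: the error state `⊥` or a pair of a computation and a store. -/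
inductive DConf : Type
  | bot : DConf
  | conf : DComp → DStore → DConf

/-- Put the computation of a configuration into a context; `⊥` stays `⊥`. -/
def DConf.inCtx (C : DCtx) : DConf → DConf
  | .bot => .bot
  | .conf M θ => .conf (C.plug M) θ

/-- The `β`-steps `⟨M, θ⟩ →β R` of `DEL_one` (not closed under contexts). A label is fresh when
it is not in the domain of the store. -/
inductive DBeta : DComp → DStore → DConf → Prop
  | pcase (V₁ V₂ : DVal) (M : DComp) (θ : DStore) :
      DBeta (.pcase (.pair V₁ V₂) M) θ (.conf (M.inst2 V₁ V₂) θ)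
  | scase (L : Tag) (V : DVal) (B : DBrs) (M : DComp) (θ : DStore) :
      B.find L = some M → DBeta (.scase (.inj L V) B) θ (.conf (M.inst V) θ)
  | force (M : DComp) (θ : DStore) :
      DBeta (.force (.thunk M)) θ (.conf M θ)
  | seq (V : DVal) (M : DComp) (θ : DStore) :
      DBeta (.seq (.ret V) M) θ (.conf (M.inst V) θ)
  | app (M : DComp) (V : DVal) (θ : DStore) :
      DBeta (.app (.lam M) V) θ (.conf (M.inst V) θ)
  | prj₁ (M N : DComp) (θ : DStore) :
      DBeta (.prj 0 (.cpair M N)) θ (.conf M θ)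
  | prj₂ (M N : DComp) (θ : DStore) :
      DBeta (.prj 1 (.cpair M N)) θ (.conf N θ)
  | ret (V : DVal) (M : DComp) (θ : DStore) :
      DBeta (.dollar (.ret V) M) θ (.conf (M.inst V) θ)
  | shift (H : DPCtx) (M N : DComp) (θ : DStore) (l : Label) :
      l ∉ θ →
      DBeta (.dollar (H.plug (.shift M)) N) θ
        (.conf (M.inst (.lab l)) (θ.insert l (.full ⟨H, N⟩)))
  | throw (l : Label) (V : DVal) (H : DPCtx) (N : DComp) (θ : DStore) :
      θ.lookup l = some (.full ⟨H, N⟩) →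
      DBeta (.throw (.lab l) V) θ
        (.conf (.dollar (H.plug (.ret V)) N) (θ.insert l .nil))
  | fail (l : Label) (V : DVal) (θ : DStore) :
      θ.lookup l = some .nil → DBeta (.throw (.lab l) V) θ .bot

/-! ### The calculus `AC` of asymmetric coroutines -/

mutual
/-- Values of `AC`. -/
inductive AVal : Type
  | var : ℕ → AVal
  | unit : AVal
  | lab : Label → AVal
  | pair : AVal → AVal → AVal
  | inj : Tag → AVal → AVal
  | thunk : AComp → AVal
/-- Computations of `AC`; the constructors shared with `DEL_one` are as there, and
`label l M` is the labelled computation `l : M`, in which the coroutine `l` is active. -/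
inductive AComp : Type
  | pcase : AVal → AComp → AComp
  | scase : AVal → ABrs → AComp
  | force : AVal → AComp
  | ret : AVal → AComp
  | seq : AComp → AComp → AComp
  | lam : AComp → AComp
  | app : AComp → AVal → AComp
  | cpair : AComp → AComp → AComp
  | prj : Fin 2 → AComp → AComp
  | label : Label → AComp → AComp
  | create : AVal → AComp
  | resume : AVal → AVal → AComp
  | yield : AVal → AComp
/-- Finite families of branches. -/
inductive ABrs : Type
  | nil : ABrs
  | cons : Tag → AComp → ABrs → ABrs
end

mutual
/-- Renaming of variables. -/
def AVal.ren (ρ : ℕ → ℕ) : AVal → AVal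
  | .var n => .var (ρ n)
  | .unit => .unit
  | .lab l => .lab l
  | .pair V W => .pair (V.ren ρ) (W.ren ρ)
  | .inj L V => .inj L (V.ren ρ)
  | .thunk M => .thunk (M.ren ρ)
def AComp.ren (ρ : ℕ → ℕ) : AComp → AComp
  | .pcase V M => .pcase (V.ren ρ) (M.ren (liftR (liftR ρ)))
  | .scase V B => .scase (V.ren ρ) (B.ren ρ)
  | .force V => .force (V.ren ρ)
  | .ret V => .ret (V.ren ρ)
  | .seq M N => .seq (M.ren ρ) (N.ren (liftR ρ))
  | .lam M => .lam (M.ren (liftR ρ))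
  | .app M V => .app (M.ren ρ) (V.ren ρ)
  | .cpair M N => .cpair (M.ren ρ) (N.ren ρ)
  | .prj i M => .prj i (M.ren ρ)
  | .label l M => .label l (M.ren ρ)
  | .create V => .create (V.ren ρ)
  | .resume V W => .resume (V.ren ρ) (W.ren ρ)
  | .yield V => .yield (V.ren ρ)
def ABrs.ren (ρ : ℕ → ℕ) : ABrs → ABrs
  | .nil => .nil
  | .cons L M B => .cons L (M.ren (liftR ρ)) (B.ren ρ)
end

/-- The action of a substitution below one binder. -/
def AVal.up (σ : ℕ → AVal) : ℕ → AVal :=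
  scons (.var 0) (fun n => (σ n).ren Nat.succ)

mutual
/-- Simultaneous substitution. -/
def AVal.sub (σ : ℕ → AVal) : AVal → AVal
  | .var n => σ n
  | .unit => .unit
  | .lab l => .lab l
  | .pair V W => .pair (V.sub σ) (W.sub σ)
  | .inj L V => .inj L (V.sub σ)
  | .thunk M => .thunk (M.sub σ)
def AComp.sub (σ : ℕ → AVal) : AComp → AComp
  | .pcase V M => .pcase (V.sub σ) (M.sub (AVal.up (AVal.up σ)))
  | .scase V B => .scase (V.sub σ) (B.sub σ)
  | .force V => .force (V.sub σ)
  | .ret V => .ret (V.sub σ)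
  | .seq M N => .seq (M.sub σ) (N.sub (AVal.up σ))
  | .lam M => .lam (M.sub (AVal.up σ))
  | .app M V => .app (M.sub σ) (V.sub σ)
  | .cpair M N => .cpair (M.sub σ) (N.sub σ)
  | .prj i M => .prj i (M.sub σ)
  | .label l M => .label l (M.sub σ)
  | .create V => .create (V.sub σ)
  | .resume V W => .resume (V.sub σ) (W.sub σ)
  | .yield V => .yield (V.sub σ)
def ABrs.sub (σ : ℕ → AVal) : ABrs → ABrs
  | .nil => .nil
  | .cons L M B => .cons L (M.sub (AVal.up σ)) (B.sub σ)
end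

/-- `M[V/x]`, where `x` is index `0`. -/
def AComp.inst (M : AComp) (V : AVal) : AComp := M.sub (scons V AVal.var)

/-- `M[V₁/x₁, V₂/x₂]`, where `x₁` is index `1` and `x₂` is index `0`. -/
def AComp.inst2 (M : AComp) (V₁ V₂ : AVal) : AComp :=
  M.sub (scons V₂ (scons V₁ AVal.var))

/-- The branch of a case distinction that belongs to a tag. -/
def ABrs.find (L : Tag) : ABrs → Option AComp
  | .nil => none
  | .cons L' M B => if L' = L then some M else B.find L

mutual
/-- The set of active labels of an expression: all `l` for which a labelled computation `l : M`
occurs in it. -/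
def AVal.active : AVal → Set Label
  | .var _ => ∅
  | .unit => ∅
  | .lab _ => ∅
  | .pair V W => V.active ∪ W.active
  | .inj _ V => V.active
  | .thunk M => M.active
def AComp.active : AComp → Set Label
  | .pcase V M => V.active ∪ M.active
  | .scase V B => V.active ∪ B.active
  | .force V => V.active
  | .ret V => V.active
  | .seq M N => M.active ∪ N.active
  | .lam M => M.active
  | .app M V => M.active ∪ V.active
  | .cpair M N => M.active ∪ N.active
  | .prj _ M => M.active
  | .label l M => {l} ∪ M.active
  | .create V => V.active
  | .resume V W => V.active ∪ W.active
  | .yield V => V.active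
def ABrs.active : ABrs → Set Label
  | .nil => ∅
  | .cons _ M B => M.active ∪ B.active
end

/-- Pure contexts of `AC`. -/
inductive APCtx : Type
  | hole : APCtx
  | seq : APCtx → AComp → APCtx
  | app : APCtx → AVal → APCtx
  | prj : Fin 2 → APCtx → APCtx

/-- `H[M]`. -/
def APCtx.plug : APCtx → AComp → AComp
  | .hole, M => M
  | .seq H N, M => .seq (H.plug M) N
  | .app H V, M => .app (H.plug M) V
  | .prj i H, M => .prj i (H.plug M)

/-- Renaming of variables in a pure context. -/
def APCtx.ren (ρ : ℕ → ℕ) : APCtx → APCtx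
  | .hole => .hole
  | .seq H N => .seq (H.ren ρ) (N.ren (liftR ρ))
  | .app H V => .app (H.ren ρ) (V.ren ρ)
  | .prj i H => .prj i (H.ren ρ)

/-- The value `{λy. H[return y]}` with `y` not free in `H`. -/
def APCtx.reify (H : APCtx) : AVal :=
  .thunk (.lam ((H.ren Nat.succ).plug (.ret (.var 0))))

/-- Evaluation contexts of `AC`; `label l D` is `l : D[ ]`. -/
inductive ACtx : Type
  | hole : ACtx
  | seq : ACtx → AComp → ACtx
  | app : ACtx → AVal → ACtx
  | prj : Fin 2 → ACtx → ACtx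
  | label : Label → ACtx → ACtx

/-- `D[M]`. -/
def ACtx.plug : ACtx → AComp → AComp
  | .hole, M => M
  | .seq D N, M => .seq (D.plug M) N
  | .app D V, M => .app (D.plug M) V
  | .prj i D, M => .prj i (D.plug M)
  | .label l D, M => .label l (D.plug M)

/-- Stores of `AC`: finite partial maps from coroutine labels to values or `nil`. -/
abbrev AStore := Finmap (fun _ : Label => Slot AVal)

/-- Configurations of `AC`. -/
inductive AConf : Type
  | bot : AConf
  | conf : AComp → AStore → AConf

/-- Put the computation of a configuration into a context; `⊥` stays `⊥`. -/
def AConf.inCtx (D : ACtx) : AConf → AConf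
  | .bot => .bot
  | .conf N τ => .conf (D.plug N) τ

/-- The `β`-steps of `AC` (not closed under contexts). -/
inductive ABeta : AComp → AStore → AConf → Prop
  | pcase (V₁ V₂ : AVal) (M : AComp) (τ : AStore) :
      ABeta (.pcase (.pair V₁ V₂) M) τ (.conf (M.inst2 V₁ V₂) τ)
  | scase (L : Tag) (V : AVal) (B : ABrs) (M : AComp) (τ : AStore) :
      B.find L = some M → ABeta (.scase (.inj L V) B) τ (.conf (M.inst V) τ)
  | force (M : AComp) (τ : AStore) :
      ABeta (.force (.thunk M)) τ (.conf M τ)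
  | seq (V : AVal) (M : AComp) (τ : AStore) :
      ABeta (.seq (.ret V) M) τ (.conf (M.inst V) τ)
  | app (M : AComp) (V : AVal) (τ : AStore) :
      ABeta (.app (.lam M) V) τ (.conf (M.inst V) τ)
  | prj₁ (M N : AComp) (τ : AStore) :
      ABeta (.prj 0 (.cpair M N)) τ (.conf M τ)
  | prj₂ (M N : AComp) (τ : AStore) :
      ABeta (.prj 1 (.cpair M N)) τ (.conf N τ)
  | create (V : AVal) (τ : AStore) (l : Label) :
      l ∉ τ → ABeta (.create V) τ (.conf (.ret (.lab l)) (τ.insert l (.full V)))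
  | resume (l : Label) (V W : AVal) (τ : AStore) :
      τ.lookup l = some (.full V) →
      ABeta (.resume (.lab l) W) τ
        (.conf (.label l (.app (.force V) W)) (τ.insert l .nil))
  | fail (l : Label) (W : AVal) (τ : AStore) :
      τ.lookup l = some .nil → ABeta (.resume (.lab l) W) τ .bot
  | ret (l : Label) (V : AVal) (τ : AStore) :
      ABeta (.label l (.ret V)) τ (.conf (.ret V) τ)
  | yield (l : Label) (H : APCtx) (V : AVal) (τ : AStore) :
      ABeta (.label l (H.plug (.yield V))) τ
        (.conf (.ret V) (τ.insert l (.full H.reify)))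

/-- The reduction relation of `AC`: `β`-steps in evaluation contexts. -/
inductive AStep : AConf → AConf → Prop
  | mk (D : ACtx) (N : AComp) (τ : AStore) (R : AConf) :
      ABeta N τ R → AStep (.conf (D.plug N) τ) (R.inCtx D)

/-- Well-formedness of `AC`-computations. -/
inductive AComp.WF : AComp → Prop
  | pcase {V : AVal} {M : AComp} : V.active ∪ M.active = ∅ → AComp.WF (.pcase V M)
  | scase {V : AVal} {B : ABrs} : V.active ∪ B.active = ∅ → AComp.WF (.scase V B)
  | force {V : AVal} : V.active = ∅ → AComp.WF (.force V)
  | ret {V : AVal} : V.active = ∅ → AComp.WF (.ret V)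
  | seq {M N : AComp} : AComp.WF M → N.active = ∅ → AComp.WF (.seq M N)
  | lam {M : AComp} : M.active = ∅ → AComp.WF (.lam M)
  | app {M : AComp} {V : AVal} : AComp.WF M → V.active = ∅ → AComp.WF (.app M V)
  | cpair {M N : AComp} : M.active ∪ N.active = ∅ → AComp.WF (.cpair M N)
  | prj {i : Fin 2} {M : AComp} : AComp.WF M → AComp.WF (.prj i M)
  | label {l : Label} {M : AComp} : AComp.WF M → l ∉ M.active → AComp.WF (.label l M)
  | create {V : AVal} : V.active = ∅ → AComp.WF (.create V)
  | resume {V W : AVal} : V.active ∪ W.active = ∅ → AComp.WF (.resume V W)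
  | yield {V : AVal} : V.active = ∅ → AComp.WF (.yield V)

/-- Well-formedness of the configuration `⟨N, τ⟩`. -/
structure WellFormed (N : AComp) (τ : AStore) : Prop where
  comp : N.WF
  store : ∀ l V, τ.lookup l = some (.full V) → V.active = ∅
  active_nil : ∀ l ∈ N.active, τ.lookup l = some .nil

/-! ### Auxiliary `AC`-programs: numerals, reference cells, failure -/

def tagZero : Tag := 0
def tagSucc : Tag := 1
def tagTrue : Tag := 2
def tagFalse : Tag := 3
def tagGet : Tag := 4
def tagSet : Tag := 5

/-- Unary numerals: `inj_Zero ()` and `inj_Succ n`. -/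
def num : ℕ → AVal
  | 0 => .inj tagZero .unit
  | n + 1 => .inj tagSucc (num n)

/-- `incr = {λn. return (inj_Succ n)}`. -/
def incrV : AVal := .thunk (.lam (.ret (.inj tagSucc (.var 0))))

/-- `{λf. λa. λb. case a of {Zero _ ↦ case b of {Zero _ ↦ return True; Succ _ ↦ return False};`
`Succ a₁ ↦ case b of {Zero _ ↦ return False; Succ b₁ ↦ f! f a₁ b₁}}}`. -/
def compareStep : AVal :=
  .thunk (.lam (.lam (.lam (.scase (.var 1)
    (.cons tagZero
      (.scase (.var 1)
        (.cons tagZero (.ret (.inj tagTrue .unit))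
        (.cons tagSucc (.ret (.inj tagFalse .unit)) .nil)))
    (.cons tagSucc
      (.scase (.var 1)
        (.cons tagZero (.ret (.inj tagFalse .unit))
        (.cons tagSucc
          (.app (.app (.app (.force (.var 4)) (.var 4)) (.var 1)) (.var 0)) .nil)))
    .nil))))))

/-- Equality test of numerals, by self-application. -/
def compareV : AVal := .thunk (.app (.force compareStep) compareStep)

/-- The body of a reference cell:
`{λf. λs. λc. case c of {Get _ ↦ c₁ ← yield s; f! f s c₁; Set t ↦ c₁ ← yield (); f! f t c₁}}`. -/
def cellStep : AVal :=
  .thunk (.lam (.lam (.lam (.scase (.var 0)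
    (.cons tagGet
      (.seq (.yield (.var 2))
        (.app (.app (.app (.force (.var 4)) (.var 4)) (.var 3)) (.var 0)))
    (.cons tagSet
      (.seq (.yield .unit)
        (.app (.app (.app (.force (.var 4)) (.var 4)) (.var 1)) (.var 0)))
    .nil))))))

/-- The coroutine `{λy. c ← return y; cellStep! cellStep V c}`, which represents a reference cell
with content `V`. -/
def refCell (V : AVal) : AVal :=
  .thunk (.lam (.seq (.ret (.var 0))
    (.app (.app (.app (.force cellStep) cellStep) (V.ren (fun n => n + 2))) (.var 0))))

/-- `ref = {λv. create (refCell v)}`. -/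
def refV : AVal := .thunk (.lam (.create (refCell (.var 0))))

/-- `get = {λr. resume r (inj_Get ())}`. -/
def getV : AVal := .thunk (.lam (.resume (.var 0) (.inj tagGet .unit)))

/-- `set = {λr. λv. resume r (inj_Set v)}`. -/
def setV : AVal := .thunk (.lam (.lam (.resume (.var 1) (.inj tagSet (.var 0)))))

/-- `fail` resumes a coroutine that has already finished:
`{z ← create {λ_. return ()}; _ ← resume z (); resume z ()}`. -/
def failV : AVal :=
  .thunk (.seq (.create (.thunk (.lam (.ret .unit))))
    (.seq (.resume (.var 0) .unit) (.resume (.var 1) .unit)))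

/-! ### The macro-translation -/

/-- Partial maps `η` from continuation labels to triples `(z, zc, i)`: a coroutine, its counter
reference, and a number. -/
abbrev Env := Label → Option (Label × Label × ℕ)

/-- The value `((z, zc), i)`. -/
def triple (t : Label × Label × ℕ) : AVal :=
  .pair (.pair (.lab t.1) (.lab t.2.1)) (num t.2.2)

/-- `x ← N₁; return {λ_. N₂}`, where `x` is index `0` of `N₂` (and `_` is not used). -/
def coBody (N₁ N₂ : AComp) : AComp :=
  .seq N₁ (.ret (.thunk (.lam (N₂.ren Nat.succ))))

/-- `let z = create {λ_. x ← N₁; return {λ_. N₂}} in let zc = ref! Zero in`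
`let res = resume z () in res! ((z, zc), Zero)`. -/
def dollarMacro (N₁ N₂ : AComp) : AComp :=
  .seq (.create (.thunk (.lam ((coBody N₁ N₂).ren Nat.succ))))
    (.seq (.app (.force refV) (num 0))
      (.seq (.resume (.var 1) .unit)
        (.app (.force (.var 0)) (.pair (.pair (.var 2) (.var 1)) (num 0)))))

/-- `case V of ((z, zc), i) ↦ let j = get! zc in let b = compare! i j in`
`case b of {True _ ↦ let i₁ = incr! i in let _ = set! zc i₁ in let res = resume z W in`
`res! ((z, zc), i₁); False _ ↦ fail!}`.
The bound variables are, from the outside in, `(z, zc)`, `i`, `z`, `zc`, `j`, `b`, `_`, `i₁`,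
`_`, `res`. -/
def throwMacro (V W : AVal) : AComp :=
  .pcase V (.pcase (.var 1)
    (.seq (.app (.force getV) (.var 0))
      (.seq (.app (.app (.force compareV) (.var 3)) (.var 0))
        (.scase (.var 0)
          (.cons tagTrue
            (.seq (.app (.force incrV) (.var 5))
              (.seq (.app (.app (.force setV) (.var 4)) (.var 0))
                (.seq (.resume (.var 6) (W.ren (fun n => n + 9)))
                  (.app (.force (.var 0))
                    (.pair (.pair (.var 7) (.var 6)) (.var 2))))))
          (.cons tagFalse (.force failV) .nil))))))

mutual
/-- The macro-translation `⟦·⟧_η`. As `η` is partial, `⟦E⟧_η` is defined only when all labels of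
`E` are in the domain of `η`; this is always required where the translation is used below, and
the value at other labels is irrelevant. -/
def DVal.tr (η : Env) : DVal → AVal
  | .var n => .var n
  | .unit => .unit
  | .lab l => match η l with
    | some t => triple t
    | none => .unit
  | .pair V W => .pair (V.tr η) (W.tr η)
  | .inj L V => .inj L (V.tr η)
  | .thunk M => .thunk (M.tr η)
def DComp.tr (η : Env) : DComp → AComp
  | .pcase V M => .pcase (V.tr η) (M.tr η)
  | .scase V B => .scase (V.tr η) (B.tr η)
  | .force V => .force (V.tr η)
  | .ret V => .ret (V.tr η)
  | .seq M N => .seq (M.tr η) (N.tr η)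
  | .lam M => .lam (M.tr η)
  | .app M V => .app (M.tr η) (V.tr η)
  | .cpair M N => .cpair (M.tr η) (N.tr η)
  | .prj i M => .prj i (M.tr η)
  | .shift M => .yield (.thunk (.lam (M.tr η)))
  | .dollar M N => dollarMacro (M.tr η) (N.tr η)
  | .throw V W => throwMacro (V.tr η) (W.tr η)
def DBrs.tr (η : Env) : DBrs → ABrs
  | .nil => .nil
  | .cons L M B => .cons L (M.tr η) (B.tr η)
end

/-- The translation of pure contexts. -/
def DPCtx.tr (η : Env) : DPCtx → APCtx
  | .hole => .hole
  | .seq H N => .seq (H.tr η) (N.tr η)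
  | .app H V => .app (H.tr η) (V.tr η)
  | .prj i H => .prj i (H.tr η)

/-- `⟦V⟧_η` is defined and equal to `W`. -/
def TrVal (η : Env) (V : DVal) (W : AVal) : Prop := V.labels ⊆ pdom η ∧ W = V.tr η

/-- `⟦M⟧_η` is defined and equal to `N`. -/
def TrComp (η : Env) (M : DComp) (N : AComp) : Prop := M.labels ⊆ pdom η ∧ N = M.tr η

/-- `⟦H⟧_η` is defined and equal to `K`. -/
def TrPCtx (η : Env) (H : DPCtx) (K : APCtx) : Prop := H.labels ⊆ pdom η ∧ K = H.tr η

/-! ### The simulation relation -/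

/-- `getnum l τ = i`: the coroutine `l` is a reference cell with content `i`. -/
def GetNum (l : Label) (τ : AStore) (i : ℕ) : Prop :=
  τ.lookup l = some (.full (refCell (num i)))

/-- `let res = m : (x ← N₁; return {λ_. N₂}) in res! ((m, mc), i)`. -/
def running (m mc : Label) (i : ℕ) (N₁ N₂ : AComp) : AComp :=
  .seq (.label m (coBody N₁ N₂)) (.app (.force (.var 0)) (triple (m, mc, i)))

/-- `Rel η κ θ τ M N` is the relation `⟨M, θ⟩ ~_{η,κ} ⟨N, τ⟩`. -/
inductive Rel (η : Env) (κ : Label → Option Label) (θ : DStore) (τ : AStore) :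
    DComp → AComp → Prop
  | pcase {V : DVal} {M : DComp} {N : AComp} :
      TrComp η (.pcase V M) N → Rel η κ θ τ (.pcase V M) N
  | scase {V : DVal} {B : DBrs} {N : AComp} :
      TrComp η (.scase V B) N → Rel η κ θ τ (.scase V B) N
  | force {V : DVal} {N : AComp} :
      TrComp η (.force V) N → Rel η κ θ τ (.force V) N
  | ret {V : DVal} {N : AComp} :
      TrComp η (.ret V) N → Rel η κ θ τ (.ret V) N
  | lam {M : DComp} {N : AComp} :
      TrComp η (.lam M) N → Rel η κ θ τ (.lam M) N
  | cpair {M₁ M₂ : DComp} {N : AComp} :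
      TrComp η (.cpair M₁ M₂) N → Rel η κ θ τ (.cpair M₁ M₂) N
  | shift {M : DComp} {N : AComp} :
      TrComp η (.shift M) N → Rel η κ θ τ (.shift M) N
  | dollar {M₁ M₂ : DComp} {N : AComp} :
      TrComp η (.dollar M₁ M₂) N → Rel η κ θ τ (.dollar M₁ M₂) N
  | throw {V W : DVal} {N : AComp} :
      TrComp η (.throw V W) N → Rel η κ θ τ (.throw V W) N
  | seq {M₁ M₂ : DComp} {N₁ N₂ : AComp} :
      Rel η κ θ τ M₁ N₁ → TrComp η M₂ N₂ → Rel η κ θ τ (.seq M₁ M₂) (.seq N₁ N₂)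
  | app {M : DComp} {V : DVal} {N : AComp} {W : AVal} :
      Rel η κ θ τ M N → TrVal η V W → Rel η κ θ τ (.app M V) (.app N W)
  | prj {i : Fin 2} {M : DComp} {N : AComp} :
      Rel η κ θ τ M N → Rel η κ θ τ (.prj i M) (.prj i N)
  | running {M₁ M₂ : DComp} {N₁ N₂ : AComp} {m mc : Label} {i : ℕ} :
      Rel η κ θ τ M₁ N₁ → TrComp η M₂ N₂ →
      κ m = some mc → GetNum mc τ i → τ.lookup m = some .nil →
      (∀ l j, η l = some (m, mc, j) → θ.lookup l = some .nil) →
      Rel η κ θ τ (.dollar M₁ M₂) (running m mc i N₁ N₂)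

/-- The invariant conditions on `θ`, `τ`, `η` and `κ`. -/
structure IC (θ : DStore) (τ : AStore) (η : Env) (κ : Label → Option Label) : Prop where
  kappa_inj : ∀ m m' c, κ m = some c → κ m' = some c → m = m'
  kappa_disjoint : pdom κ ∩ pim κ = ∅
  kappa_dom : pdom κ ∪ pim κ = {l | l ∈ τ}
  eta_dom : pdom η = {l | l ∈ θ}
  eta_kappa : ∀ l z zc i, η l = some (z, zc, i) → κ z = some zc
  used : ∀ l z zc i, η l = some (z, zc, i) → θ.lookup l = some .nil →
    ∃ j, GetNum zc τ j ∧ i < j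
  live : ∀ l z zc i H M, η l = some (z, zc, i) → θ.lookup l = some (.full ⟨H, M⟩) →
    l ∉ M.labels ∧
    GetNum zc τ i ∧
    (∀ l' ∈ θ, l' ≠ l → ∀ zc' i', η l' = some (z, zc', i') → θ.lookup l' = some .nil) ∧
    ∃ K N, TrPCtx η H K ∧ TrComp η M N ∧
      τ.lookup z = some
        (.full (APCtx.seq K (.ret (.thunk (.lam (N.ren Nat.succ))))).reify)

/-- The simulation relation `C ~ D`. -/
def Sim (C : DConf) (D : AConf) : Prop :=
  (C = .bot ∧ D = .bot) ∨
  ∃ (M : DComp) (N : AComp) (θ : DStore) (τ : AStore) (η : Env) (κ : Label → Option Label),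
    C = .conf M θ ∧ D = .conf N τ ∧ Rel η κ θ τ M N ∧ WellFormed N τ ∧ IC θ τ η κ

end DelToAC

open DelToAC

/-!
Every delimiter of `DEL_one` is simulated by a coroutine `z` together with a reference cell `zc`
that counts how often `z` has been resumed. A captured continuation becomes a triple `((z, zc), i)`,
which is valid exactly as long as the counter still holds `i`: throwing to it increments the
counter, so every older triple for the same coroutine fails the comparison from then on.

The delimiters around a redex may still be translated terms, whose coroutines have not been created.
Evaluating these translations from the outside in turns each of them into a running coroutine
without changing the simulated configuration, after which the redex itself can be simulated. A step
affects only one coroutine, its counter and the labels that `η` sends to this pair, so the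
invariants of all other labels are preserved by framing.
-/

namespace DelToAC

/-! ### Renaming and substitution in `AC` -/

theorem liftR_comp_liftR (ρ ρ' : ℕ → ℕ) : liftR ρ' ∘ liftR ρ = liftR (ρ' ∘ ρ) := by
  funext n; cases n <;> rfl

mutual
theorem AVal.ren_ren (ρ ρ' : ℕ → ℕ) (V : AVal) : (V.ren ρ).ren ρ' = V.ren (ρ' ∘ ρ) := by
  cases V <;> simp only [AVal.ren, AVal.ren_ren, AComp.ren_ren, Function.comp_apply]
theorem AComp.ren_ren (ρ ρ' : ℕ → ℕ) (M : AComp) : (M.ren ρ).ren ρ' = M.ren (ρ' ∘ ρ) := by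
  cases M <;>
    simp only [AComp.ren, AVal.ren_ren, AComp.ren_ren, ABrs.ren_ren, liftR_comp_liftR]
theorem ABrs.ren_ren (ρ ρ' : ℕ → ℕ) (B : ABrs) : (B.ren ρ).ren ρ' = B.ren (ρ' ∘ ρ) := by
  cases B <;> simp only [ABrs.ren, AComp.ren_ren, ABrs.ren_ren, liftR_comp_liftR]
end

theorem AVal.up_zero (σ : ℕ → AVal) : AVal.up σ 0 = .var 0 := rfl

theorem AVal.up_succ (σ : ℕ → AVal) (n : ℕ) : AVal.up σ (n + 1) = (σ n).ren Nat.succ := rfl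

theorem AVal.up_comp_liftR (σ : ℕ → AVal) (ρ : ℕ → ℕ) :
    AVal.up σ ∘ liftR ρ = AVal.up (σ ∘ ρ) := by
  funext n; cases n <;> rfl

mutual
theorem AVal.sub_ren (ρ : ℕ → ℕ) (σ : ℕ → AVal) (V : AVal) :
    (V.ren ρ).sub σ = V.sub (σ ∘ ρ) := by
  cases V <;> simp only [AVal.ren, AVal.sub, AVal.sub_ren, AComp.sub_ren, Function.comp_apply]
theorem AComp.sub_ren (ρ : ℕ → ℕ) (σ : ℕ → AVal) (M : AComp) :
    (M.ren ρ).sub σ = M.sub (σ ∘ ρ) := by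
  cases M <;> simp only [AComp.ren, AComp.sub, AVal.sub_ren, AComp.sub_ren, ABrs.sub_ren,
    AVal.up_comp_liftR]
theorem ABrs.sub_ren (ρ : ℕ → ℕ) (σ : ℕ → AVal) (B : ABrs) :
    (B.ren ρ).sub σ = B.sub (σ ∘ ρ) := by
  cases B <;> simp only [ABrs.ren, ABrs.sub, AComp.sub_ren, ABrs.sub_ren, AVal.up_comp_liftR]
end

theorem AVal.ren_liftR_comp_up (ρ : ℕ → ℕ) (σ : ℕ → AVal) :
    AVal.ren (liftR ρ) ∘ AVal.up σ = AVal.up (AVal.ren ρ ∘ σ) := by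
  funext n
  cases n with
  | zero => rfl
  | succ n => simp only [Function.comp_apply, AVal.up_succ, AVal.ren_ren]; rfl

mutual
theorem AVal.ren_sub (σ : ℕ → AVal) (ρ : ℕ → ℕ) (V : AVal) :
    (V.sub σ).ren ρ = V.sub (AVal.ren ρ ∘ σ) := by
  cases V <;> simp only [AVal.ren, AVal.sub, AVal.ren_sub, AComp.ren_sub, Function.comp_apply]
theorem AComp.ren_sub (σ : ℕ → AVal) (ρ : ℕ → ℕ) (M : AComp) :
    (M.sub σ).ren ρ = M.sub (AVal.ren ρ ∘ σ) := by
  cases M <;> simp only [AComp.ren, AComp.sub, AVal.ren_sub, AComp.ren_sub, ABrs.ren_sub,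
    AVal.ren_liftR_comp_up]
theorem ABrs.ren_sub (σ : ℕ → AVal) (ρ : ℕ → ℕ) (B : ABrs) :
    (B.sub σ).ren ρ = B.sub (AVal.ren ρ ∘ σ) := by
  cases B <;> simp only [ABrs.ren, ABrs.sub, AComp.ren_sub, ABrs.ren_sub, AVal.ren_liftR_comp_up]
end

theorem AVal.up_var : AVal.up AVal.var = AVal.var := by
  funext n; cases n <;> rfl

mutual
theorem AVal.sub_var (V : AVal) : V.sub AVal.var = V := by
  cases V <;> simp only [AVal.sub] <;> simp only [AVal.sub_var, AComp.sub_var]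
theorem AComp.sub_var (M : AComp) : M.sub AVal.var = M := by
  cases M <;> simp only [AComp.sub, AVal.up_var] <;>
    simp only [AVal.sub_var, AComp.sub_var, ABrs.sub_var]
theorem ABrs.sub_var (B : ABrs) : B.sub AVal.var = B := by
  cases B
  · rfl
  · simp only [ABrs.sub, AVal.up_var]; simp only [AComp.sub_var, ABrs.sub_var]
end

theorem AVal.sub_var_comp (ρ : ℕ → ℕ) (V : AVal) : V.sub (AVal.var ∘ ρ) = V.ren ρ := by
  rw [← AVal.sub_ren, AVal.sub_var]

theorem AComp.sub_var_comp (ρ : ℕ → ℕ) (M : AComp) : M.sub (AVal.var ∘ ρ) = M.ren ρ := by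
  rw [← AComp.sub_ren, AComp.sub_var]

theorem AComp.inst_ren_succ (M : AComp) (V : AVal) : (M.ren Nat.succ).inst V = M :=
  (AComp.sub_ren _ _ M).trans M.sub_var

theorem AComp.sub_up_ren_succ (M : AComp) (σ : ℕ → AVal) :
    (M.ren Nat.succ).sub (AVal.up σ) = (M.sub σ).ren Nat.succ :=
  (AComp.sub_ren _ _ M).trans (AComp.ren_sub _ _ M).symm

mutual
theorem AVal.active_ren (ρ : ℕ → ℕ) (V : AVal) : (V.ren ρ).active = V.active := by
  cases V <;> simp only [AVal.ren, AVal.active, AVal.active_ren, AComp.active_ren]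
theorem AComp.active_ren (ρ : ℕ → ℕ) (M : AComp) : (M.ren ρ).active = M.active := by
  cases M <;>
    simp only [AComp.ren, AComp.active, AVal.active_ren, AComp.active_ren, ABrs.active_ren]
theorem ABrs.active_ren (ρ : ℕ → ℕ) (B : ABrs) : (B.ren ρ).active = B.active := by
  cases B <;> simp only [ABrs.ren, ABrs.active, AComp.active_ren, ABrs.active_ren]
end

/-! ### The macro-translation commutes with substitution -/

@[simp] theorem num_sub (σ : ℕ → AVal) (n : ℕ) : (num n).sub σ = num n := by
  induction n with
  | zero => rfl
  | succ n ih => simp only [num, AVal.sub, ih]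

@[simp] theorem num_ren (ρ : ℕ → ℕ) (n : ℕ) : (num n).ren ρ = num n := by
  rw [← AVal.sub_var_comp, num_sub]

@[simp] theorem num_active (n : ℕ) : (num n).active = ∅ := by
  induction n with
  | zero => rfl
  | succ n ih => simp only [num, AVal.active, ih]

@[simp] theorem triple_sub (σ : ℕ → AVal) (t : Label × Label × ℕ) :
    (triple t).sub σ = triple t := by
  simp only [triple, AVal.sub, num_sub]

@[simp] theorem triple_ren (ρ : ℕ → ℕ) (t : Label × Label × ℕ) : (triple t).ren ρ = triple t := by
  rw [← AVal.sub_var_comp, triple_sub]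

@[simp] theorem triple_active (t : Label × Label × ℕ) : (triple t).active = ∅ := by
  simp only [triple, AVal.active, num_active, Set.union_empty]

@[simp] theorem incrV_sub (σ : ℕ → AVal) : incrV.sub σ = incrV := rfl

@[simp] theorem compareV_sub (σ : ℕ → AVal) : compareV.sub σ = compareV := rfl

@[simp] theorem refV_sub (σ : ℕ → AVal) : refV.sub σ = refV := rfl

@[simp] theorem getV_sub (σ : ℕ → AVal) : getV.sub σ = getV := rfl

@[simp] theorem setV_sub (σ : ℕ → AVal) : setV.sub σ = setV := rfl

@[simp] theorem failV_sub (σ : ℕ → AVal) : failV.sub σ = failV := rfl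

theorem coBody_sub (σ : ℕ → AVal) (N₁ N₂ : AComp) :
    (coBody N₁ N₂).sub σ = coBody (N₁.sub σ) (N₂.sub (AVal.up σ)) := by
  simp only [coBody, AComp.sub, AVal.sub, AComp.sub_up_ren_succ]

theorem dollarMacro_sub (σ : ℕ → AVal) (N₁ N₂ : AComp) :
    (dollarMacro N₁ N₂).sub σ = dollarMacro (N₁.sub σ) (N₂.sub (AVal.up σ)) := by
  rw [dollarMacro, dollarMacro, ← coBody_sub, ← AComp.sub_up_ren_succ]
  simp only [AComp.sub, AVal.sub, refV_sub, num_sub]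
  rfl

theorem throwMacro_sub (σ : ℕ → AVal) (V W : AVal) :
    (throwMacro V W).sub σ = throwMacro (V.sub σ) (W.sub σ) := by
  simp only [throwMacro, AComp.sub, ABrs.sub, AVal.sub, getV_sub, compareV_sub, incrV_sub,
    setV_sub, failV_sub, AVal.sub_ren, AVal.ren_sub, AVal.up_zero, AVal.up_succ, AVal.ren]
  congr! 11
  funext n
  simp only [Function.comp_apply, AVal.up_succ, AVal.ren_ren]
  rfl

theorem dollarMacro_ren (ρ : ℕ → ℕ) (N₁ N₂ : AComp) :
    (dollarMacro N₁ N₂).ren ρ = dollarMacro (N₁.ren ρ) (N₂.ren (liftR ρ)) := by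
  simp only [← AComp.sub_var_comp, dollarMacro_sub, ← AVal.up_comp_liftR, AVal.up_var]

theorem throwMacro_ren (ρ : ℕ → ℕ) (V W : AVal) :
    (throwMacro V W).ren ρ = throwMacro (V.ren ρ) (W.ren ρ) := by
  simp only [← AComp.sub_var_comp, throwMacro_sub, AVal.sub_var_comp]

mutual
theorem DVal.tr_ren (η : Env) (ρ : ℕ → ℕ) (V : DVal) : (V.ren ρ).tr η = (V.tr η).ren ρ := by
  cases V
  case lab l => cases h : η l <;> simp only [DVal.ren, DVal.tr, h, AVal.ren, triple_ren]
  all_goals simp only [DVal.ren, DVal.tr, AVal.ren, DVal.tr_ren, DComp.tr_ren]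
theorem DComp.tr_ren (η : Env) (ρ : ℕ → ℕ) (M : DComp) : (M.ren ρ).tr η = (M.tr η).ren ρ := by
  cases M <;> simp only [DComp.ren, DComp.tr, AComp.ren, AVal.ren, DVal.tr_ren, DComp.tr_ren,
    DBrs.tr_ren, dollarMacro_ren, throwMacro_ren]
theorem DBrs.tr_ren (η : Env) (ρ : ℕ → ℕ) (B : DBrs) : (B.ren ρ).tr η = (B.tr η).ren ρ := by
  cases B <;> simp only [DBrs.ren, DBrs.tr, ABrs.ren, DComp.tr_ren, DBrs.tr_ren]
end

theorem DVal.tr_comp_up (η : Env) (σ : ℕ → DVal) :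
    DVal.tr η ∘ DVal.up σ = AVal.up (DVal.tr η ∘ σ) := by
  funext n
  cases n with
  | zero => rfl
  | succ n => exact DVal.tr_ren η _ _

mutual
theorem DVal.tr_sub (η : Env) (σ : ℕ → DVal) (V : DVal) :
    (V.sub σ).tr η = (V.tr η).sub (DVal.tr η ∘ σ) := by
  cases V
  case lab l => cases h : η l <;> simp only [DVal.sub, DVal.tr, h, AVal.sub, triple_sub]
  all_goals
    simp only [DVal.sub, DVal.tr, AVal.sub, DVal.tr_sub, DComp.tr_sub, Function.comp_apply]
theorem DComp.tr_sub (η : Env) (σ : ℕ → DVal) (M : DComp) :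
    (M.sub σ).tr η = (M.tr η).sub (DVal.tr η ∘ σ) := by
  cases M <;> simp only [DComp.sub, DComp.tr, AComp.sub, AVal.sub, DVal.tr_sub, DComp.tr_sub,
    DBrs.tr_sub, dollarMacro_sub, throwMacro_sub, DVal.tr_comp_up]
theorem DBrs.tr_sub (η : Env) (σ : ℕ → DVal) (B : DBrs) :
    (B.sub σ).tr η = (B.tr η).sub (DVal.tr η ∘ σ) := by
  cases B <;> simp only [DBrs.sub, DBrs.tr, ABrs.sub, DComp.tr_sub, DBrs.tr_sub, DVal.tr_comp_up]
end

theorem DComp.tr_inst (η : Env) (M : DComp) (V : DVal) :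
    (M.inst V).tr η = (M.tr η).inst (V.tr η) := by
  rw [DComp.inst, AComp.inst, DComp.tr_sub]
  congr 1
  funext n
  cases n <;> rfl

theorem DComp.tr_inst2 (η : Env) (M : DComp) (V₁ V₂ : DVal) :
    (M.inst2 V₁ V₂).tr η = (M.tr η).inst2 (V₁.tr η) (V₂.tr η) := by
  rw [DComp.inst2, AComp.inst2, DComp.tr_sub]
  congr 1
  funext n
  rcases n with _ | _ | n <;> rfl

theorem DBrs.find_tr (η : Env) (L : Tag) (B : DBrs) :
    (B.tr η).find L = (B.find L).map (DComp.tr η) := by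
  cases B with
  | nil => rfl
  | cons L' M B => by_cases h : L' = L <;> simp only [DBrs.tr, ABrs.find, DBrs.find, h, if_true,
      if_false, DBrs.find_tr, Option.map_some]

theorem DPCtx.tr_plug (η : Env) (H : DPCtx) (M : DComp) :
    (H.plug M).tr η = (H.tr η).plug (M.tr η) := by
  induction H <;> simp only [DPCtx.plug, DPCtx.tr, APCtx.plug, DComp.tr, *]

theorem DVal.tr_lab {η : Env} {l : Label} {t : Label × Label × ℕ} (h : η l = some t) :
    (DVal.lab l).tr η = triple t := by
  simp only [DVal.tr, h]

theorem coBody_active (N₁ N₂ : AComp) : (coBody N₁ N₂).active = N₁.active ∪ N₂.active := by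
  simp only [coBody, AComp.active, AVal.active, AComp.active_ren]

theorem refCell_active (V : AVal) : (refCell V).active = V.active := by
  simp [refCell, cellStep, AVal.active, AComp.active, ABrs.active, AVal.active_ren]

theorem dollarMacro_active (N₁ N₂ : AComp) :
    (dollarMacro N₁ N₂).active = N₁.active ∪ N₂.active := by
  simp [dollarMacro, coBody_active, AComp.active_ren, AComp.active, AVal.active, refV,
    refCell_active]

theorem throwMacro_active (V W : AVal) : (throwMacro V W).active = V.active ∪ W.active := by
  simp [throwMacro, AVal.active_ren, AComp.active, AVal.active, ABrs.active, getV, compareV,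
    compareStep, incrV, setV, failV]

mutual
theorem DVal.active_tr (η : Env) (V : DVal) : (V.tr η).active = ∅ := by
  cases V
  case lab l => cases h : η l <;> simp only [DVal.tr, h, AVal.active, triple_active]
  all_goals simp only [DVal.tr, AVal.active, DVal.active_tr, DComp.active_tr, Set.union_empty]
theorem DComp.active_tr (η : Env) (M : DComp) : (M.tr η).active = ∅ := by
  cases M <;> simp only [DComp.tr, AComp.active, AVal.active, dollarMacro_active,
    throwMacro_active, DVal.active_tr, DComp.active_tr, DBrs.active_tr, Set.union_empty]
theorem DBrs.active_tr (η : Env) (B : DBrs) : (B.tr η).active = ∅ := by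
  cases B <;> simp only [DBrs.tr, ABrs.active, DComp.active_tr, DBrs.active_tr, Set.union_empty]
end

mutual
theorem DVal.tr_congr {η η' : Env} {V : DVal} (h : Set.EqOn η η' V.labels) :
    V.tr η = V.tr η' := by
  cases V <;> simp only [DVal.labels, Set.eqOn_union, Set.eqOn_singleton] at h <;>
    simp only [DVal.tr]
  case lab => rw [h]
  case pair => rw [DVal.tr_congr h.1, DVal.tr_congr h.2]
  case inj => rw [DVal.tr_congr h]
  case thunk => rw [DComp.tr_congr h]
theorem DComp.tr_congr {η η' : Env} {M : DComp} (h : Set.EqOn η η' M.labels) :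
    M.tr η = M.tr η' := by
  cases M <;> simp only [DComp.labels, Set.eqOn_union] at h <;> simp only [DComp.tr]
  case pcase => rw [DVal.tr_congr h.1, DComp.tr_congr h.2]
  case scase => rw [DVal.tr_congr h.1, DBrs.tr_congr h.2]
  case force | ret => rw [DVal.tr_congr h]
  case lam | prj | shift => rw [DComp.tr_congr h]
  case app => rw [DComp.tr_congr h.1, DVal.tr_congr h.2]
  case seq | cpair | dollar => rw [DComp.tr_congr h.1, DComp.tr_congr h.2]
  case throw => rw [DVal.tr_congr h.1, DVal.tr_congr h.2]
theorem DBrs.tr_congr {η η' : Env} {B : DBrs} (h : Set.EqOn η η' B.labels) :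
    B.tr η = B.tr η' := by
  cases B with
  | nil => rfl
  | cons =>
    rw [DBrs.labels, Set.eqOn_union] at h
    rw [DBrs.tr, DBrs.tr, DComp.tr_congr h.1, DBrs.tr_congr h.2]
end

theorem DPCtx.tr_congr {η η' : Env} {H : DPCtx} (h : Set.EqOn η η' H.labels) :
    H.tr η = H.tr η' := by
  induction H with
  | hole => rfl
  | seq H N ih =>
    rw [DPCtx.labels, Set.eqOn_union] at h
    rw [DPCtx.tr, DPCtx.tr, ih h.1, DComp.tr_congr h.2]
  | app H V ih =>
    rw [DPCtx.labels, Set.eqOn_union] at h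
    rw [DPCtx.tr, DPCtx.tr, ih h.1, DVal.tr_congr h.2]
  | prj i H ih => rw [DPCtx.tr, DPCtx.tr, ih h]

/-! ### Labels of `DEL_one`-expressions -/

mutual
theorem DVal.labels_ren (ρ : ℕ → ℕ) (V : DVal) : (V.ren ρ).labels = V.labels := by
  cases V <;> simp only [DVal.ren, DVal.labels, DVal.labels_ren, DComp.labels_ren]
theorem DComp.labels_ren (ρ : ℕ → ℕ) (M : DComp) : (M.ren ρ).labels = M.labels := by
  cases M <;>
    simp only [DComp.ren, DComp.labels, DVal.labels_ren, DComp.labels_ren, DBrs.labels_ren]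
theorem DBrs.labels_ren (ρ : ℕ → ℕ) (B : DBrs) : (B.ren ρ).labels = B.labels := by
  cases B <;> simp only [DBrs.ren, DBrs.labels, DComp.labels_ren, DBrs.labels_ren]
end

theorem DVal.labels_up_subset {S : Set Label} {σ : ℕ → DVal} (hσ : ∀ n, (σ n).labels ⊆ S) (n : ℕ) :
    (DVal.up σ n).labels ⊆ S := by
  cases n with
  | zero => exact Set.empty_subset S
  | succ n => exact (DVal.labels_ren _ _).trans_subset (hσ n)

mutual
theorem DVal.labels_sub_subset {S : Set Label} {σ : ℕ → DVal} (hσ : ∀ n, (σ n).labels ⊆ S)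
    {V : DVal} (hV : V.labels ⊆ S) :
    (V.sub σ).labels ⊆ S := by
  cases V <;> simp only [DVal.sub, DVal.labels, Set.union_subset_iff] at hV ⊢
  case var n => exact hσ n
  case unit => exact hV
  case lab => exact hV
  case pair => exact ⟨DVal.labels_sub_subset hσ hV.1, DVal.labels_sub_subset hσ hV.2⟩
  case inj => exact DVal.labels_sub_subset hσ hV
  case thunk => exact DComp.labels_sub_subset hσ hV
theorem DComp.labels_sub_subset {S : Set Label} {σ : ℕ → DVal} (hσ : ∀ n, (σ n).labels ⊆ S)
    {M : DComp} (hM : M.labels ⊆ S) :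
    (M.sub σ).labels ⊆ S := by
  have hup := DVal.labels_up_subset hσ
  cases M <;> simp only [DComp.sub, DComp.labels, Set.union_subset_iff] at hM ⊢
  case pcase => exact ⟨DVal.labels_sub_subset hσ hM.1,
    DComp.labels_sub_subset (DVal.labels_up_subset hup) hM.2⟩
  case scase => exact ⟨DVal.labels_sub_subset hσ hM.1, DBrs.labels_sub_subset hσ hM.2⟩
  case force | ret => exact DVal.labels_sub_subset hσ hM
  case lam | shift => exact DComp.labels_sub_subset hup hM
  case prj => exact DComp.labels_sub_subset hσ hM
  case seq | dollar => exact ⟨DComp.labels_sub_subset hσ hM.1, DComp.labels_sub_subset hup hM.2⟩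
  case app => exact ⟨DComp.labels_sub_subset hσ hM.1, DVal.labels_sub_subset hσ hM.2⟩
  case cpair => exact ⟨DComp.labels_sub_subset hσ hM.1, DComp.labels_sub_subset hσ hM.2⟩
  case throw => exact ⟨DVal.labels_sub_subset hσ hM.1, DVal.labels_sub_subset hσ hM.2⟩
theorem DBrs.labels_sub_subset {S : Set Label} {σ : ℕ → DVal} (hσ : ∀ n, (σ n).labels ⊆ S)
    {B : DBrs} (hB : B.labels ⊆ S) :
    (B.sub σ).labels ⊆ S := by
  cases B <;> simp only [DBrs.sub, DBrs.labels, Set.union_subset_iff] at hB ⊢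
  case nil => exact hB
  case cons => exact ⟨DComp.labels_sub_subset (DVal.labels_up_subset hσ) hB.1,
    DBrs.labels_sub_subset hσ hB.2⟩
end

theorem DComp.labels_inst_subset (M : DComp) (V : DVal) :
    (M.inst V).labels ⊆ V.labels ∪ M.labels := by
  refine DComp.labels_sub_subset (fun n => ?_) Set.subset_union_right
  cases n with
  | zero => exact Set.subset_union_left
  | succ => exact Set.empty_subset _

theorem DComp.labels_inst2_subset (M : DComp) (V₁ V₂ : DVal) :
    (M.inst2 V₁ V₂).labels ⊆ V₁.labels ∪ V₂.labels ∪ M.labels := by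
  refine DComp.labels_sub_subset (fun n => ?_) Set.subset_union_right
  rcases n with _ | _ | _
  · exact Set.subset_union_right.trans Set.subset_union_left
  · exact Set.subset_union_left.trans Set.subset_union_left
  · exact Set.empty_subset _

theorem DBrs.labels_subset_of_find {L : Tag} {B : DBrs} {M : DComp} (h : B.find L = some M) :
    M.labels ⊆ B.labels := by
  cases B with
  | nil => exact absurd h (Option.some_ne_none M).symm
  | cons L' N B =>
    rw [DBrs.find] at h
    split_ifs at h
    · exact Option.some_injective _ h ▸ Set.subset_union_left
    · exact (DBrs.labels_subset_of_find h).trans Set.subset_union_right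

theorem DPCtx.labels_plug (H : DPCtx) (M : DComp) : (H.plug M).labels = H.labels ∪ M.labels := by
  induction H with
  | hole => exact (Set.empty_union _).symm
  | seq H N ih | app H V ih => rw [DPCtx.plug, DComp.labels, ih, DPCtx.labels, Set.union_right_comm]
  | prj _ _ ih => exact ih

/-! ### Evaluation contexts and reduction of `AC` -/

/-- The composition `D[E[ ]]` of evaluation contexts of `AC`. -/
def ACtx.comp : ACtx → ACtx → ACtx
  | .hole, E => E
  | .seq D N, E => .seq (D.comp E) N
  | .app D V, E => .app (D.comp E) V
  | .prj i D, E => .prj i (D.comp E)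
  | .label l D, E => .label l (D.comp E)

theorem ACtx.plug_comp (D E : ACtx) (N : AComp) : (D.comp E).plug N = D.plug (E.plug N) := by
  induction D <;> simp only [ACtx.comp, ACtx.plug, *]

theorem AStep.inCtx {R R' : AConf} (h : AStep R R') (D : ACtx) :
    AStep (R.inCtx D) (R'.inCtx D) := by
  obtain ⟨E, N, τ, R', hβ⟩ := h
  cases R' <;> simpa only [AConf.inCtx, ACtx.plug_comp] using AStep.mk (D.comp E) N τ _ hβ

/-- Reduction of `AC` in one or more steps. -/
abbrev APlus : AConf → AConf → Prop := Relation.TransGen AStep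

/-- Reduction of `AC` in any number of steps. -/
abbrev AStar : AConf → AConf → Prop := Relation.ReflTransGen AStep

local infix:50 "⟶⁺" => APlus

local infix:50 "⟶*" => AStar

theorem APlus.inCtx {R R' : AConf} (h : R ⟶⁺ R') (D : ACtx) : R.inCtx D ⟶⁺ R'.inCtx D :=
  h.lift (AConf.inCtx D) fun _ _ h => h.inCtx D

theorem ABeta.plus {N : AComp} {τ : AStore} {R : AConf} (h : ABeta N τ R) : .conf N τ ⟶⁺ R := by
  have hstep := AStep.mk .hole N τ R h
  cases R <;> exact .single hstep

section

variable {M M' N : AComp} {V W : AVal} {τ τ' : AStore}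

theorem APlus.seq (h : .conf M τ ⟶⁺ .conf M' τ') (N : AComp) :
    .conf (.seq M N) τ ⟶⁺ .conf (.seq M' N) τ' :=
  h.inCtx (.seq .hole N)

theorem APlus.app (h : .conf M τ ⟶⁺ .conf M' τ') (V : AVal) :
    .conf (.app M V) τ ⟶⁺ .conf (.app M' V) τ' :=
  h.inCtx (.app .hole V)

theorem APlus.label (h : .conf M τ ⟶⁺ .conf M' τ') (l : Label) :
    .conf (.label l M) τ ⟶⁺ .conf (.label l M') τ' :=
  h.inCtx (.label l .hole)

theorem APlus.bind (h : .conf M τ ⟶⁺ .conf (.ret V) τ') (hN : N.inst V = M') :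
    .conf (.seq M N) τ ⟶⁺ .conf M' τ' :=
  (h.seq N).trans (hN ▸ (ABeta.seq V N τ').plus)

theorem APlus.pcase (h : M.inst2 V W = N) :
    .conf (.pcase (.pair V W) M) τ ⟶⁺ .conf N τ :=
  h ▸ (ABeta.pcase V W M τ).plus

theorem APlus.scase {L : Tag} {B : ABrs} (hB : B.find L = some M) (h : M.inst V = N) :
    .conf (.scase (.inj L V) B) τ ⟶⁺ .conf N τ :=
  h ▸ (ABeta.scase L V B M τ hB).plus

theorem APlus.call (M : AComp) (V : AVal) (τ : AStore) :
    .conf (.app (.force (.thunk (.lam M))) V) τ ⟶⁺ .conf (M.inst V) τ :=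
  ((ABeta.force _ τ).plus.app V).trans (ABeta.app M V τ).plus

theorem APlus.call₂ (M : AComp) (V W : AVal) (τ : AStore) :
    .conf (.app (.app (.force (.thunk (.lam (.lam M)))) V) W) τ ⟶⁺
      .conf ((M.sub (AVal.up (scons V AVal.var))).inst W) τ :=
  ((APlus.call _ V τ).app W).trans (ABeta.app _ W τ).plus

theorem APlus.call₃ (M : AComp) (U V W : AVal) (τ : AStore) :
    .conf (.app (.app (.app (.force (.thunk (.lam (.lam (.lam M))))) U) V) W) τ ⟶⁺
      .conf (((M.sub (AVal.up (AVal.up (scons U AVal.var)))).sub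
        (AVal.up (scons V AVal.var))).inst W) τ :=
  ((APlus.call₂ _ U V τ).app W).trans (ABeta.app _ W τ).plus

theorem APlus.resume {l : Label} (hl : τ.lookup l = some (.full (.thunk (.lam M))))
    (h : M.inst W = N) :
    .conf (.resume (.lab l) W) τ ⟶⁺ .conf (.label l N) (τ.insert l .nil) :=
  (ABeta.resume l _ W τ hl).plus.trans (h ▸ (APlus.call M W _).label l)

end

/-! ### Runs of the auxiliary programs -/

theorem insert_of_lookup_eq_some {α : Type*} {β : α → Type*} [DecidableEq α] {s : Finmap β}
    {a : α} {b : β a} (h : s.lookup a = some b) : s.insert a b = s := by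
  refine Finmap.ext_lookup fun x => ?_
  by_cases hx : x = a
  · subst hx
    rw [Finmap.lookup_insert, h]
  · rw [Finmap.lookup_insert_of_ne _ hx]

theorem exists_notMem {α : Type*} [Infinite α] {β : α → Type*} (s : Finmap β) : ∃ a, a ∉ s := by
  obtain ⟨a, ha⟩ := Infinite.exists_notMem_finset s.keys
  exact ⟨a, mt Finmap.mem_keys.2 ha⟩

theorem AVal.sub_var_fun (ρ : ℕ → ℕ) (V : AVal) : V.sub (fun n => .var (ρ n)) = V.ren ρ :=
  V.sub_var_comp ρ

section

attribute [local simp] AComp.inst AComp.inst2 AComp.sub ABrs.sub AVal.sub AComp.ren AVal.ren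
  AVal.sub_ren AVal.ren_ren AVal.up_zero AVal.up_succ scons liftR AVal.sub_var AVal.sub_var_fun
  Function.comp_def

@[simp]
theorem cellStep_ren (ρ : ℕ → ℕ) : cellStep.ren ρ = cellStep := rfl

@[simp]
theorem cellStep_sub (σ : ℕ → AVal) : cellStep.sub σ = cellStep := rfl

/-- `cellStep! cellStep i c`: the reference cell with content `i` treats the request `c`. -/
def cellLoop (i : ℕ) (c : AVal) : AComp :=
  .app (.app (.app (.force cellStep) cellStep) (num i)) c

theorem refCell_run (i : ℕ) (c : AVal) (τ : AStore) :
    .conf (.app (.force (refCell (num i))) c) τ ⟶⁺ .conf (cellLoop i c) τ := by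
  refine (APlus.call _ c τ).trans (ABeta.plus ?_)
  simpa [cellLoop] using ABeta.seq c (cellLoop i (.var 0)) τ

theorem reify_cellLoop (i : ℕ) :
    (APCtx.seq .hole (cellLoop i (.var 0))).reify = refCell (num i) := by
  simp [APCtx.reify, APCtx.ren, APCtx.plug, cellLoop, refCell]

theorem cellLoop_get (i : ℕ) (τ : AStore) :
    .conf (cellLoop i (.inj tagGet .unit)) τ ⟶⁺
      .conf (.seq (.yield (num i)) (cellLoop i (.var 0))) τ := by
  refine (APlus.call₃ _ _ _ _ τ).trans ?_
  simp only [AComp.inst, AComp.sub, ABrs.sub, AVal.sub]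
  refine APlus.scase rfl ?_
  simp [cellLoop]

theorem cellLoop_set (i k : ℕ) (τ : AStore) :
    .conf (cellLoop i (.inj tagSet (num k))) τ ⟶⁺
      .conf (.seq (.yield .unit) (cellLoop k (.var 0))) τ := by
  refine (APlus.call₃ _ _ _ _ τ).trans ?_
  simp only [AComp.inst, AComp.sub, ABrs.sub, AVal.sub]
  refine APlus.scase rfl ?_
  simp [cellLoop]

theorem resume_refCell {l : Label} {i k : ℕ} {c V : AVal} {τ : AStore} (hl : GetNum l τ i)
    (h : ∀ τ', .conf (cellLoop i c) τ' ⟶⁺ .conf (.seq (.yield V) (cellLoop k (.var 0))) τ') :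
    .conf (.resume (.lab l) c) τ ⟶⁺ .conf (.ret V) (τ.insert l (.full (refCell (num k)))) := by
  have hyield := (ABeta.yield l (.seq .hole (cellLoop k (.var 0))) V (τ.insert l .nil)).plus
  rw [reify_cellLoop, Finmap.insert_insert] at hyield
  calc AConf.conf (.resume (.lab l) c) τ
    _ ⟶⁺ .conf (.label l (.app (.force (refCell (num i))) c)) (τ.insert l .nil) :=
      (ABeta.resume l _ c τ hl).plus
    _ ⟶⁺ .conf (.label l (cellLoop i c)) (τ.insert l .nil) := (refCell_run i c _).label l
    _ ⟶⁺ .conf (.label l (.seq (.yield V) (cellLoop k (.var 0)))) (τ.insert l .nil) :=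
      (h _).label l
    _ ⟶⁺ .conf (.ret V) (τ.insert l (.full (refCell (num k)))) := hyield

theorem getV_run {l : Label} {i : ℕ} {τ : AStore} (hl : GetNum l τ i) :
    .conf (.app (.force getV) (.lab l)) τ ⟶⁺ .conf (.ret (num i)) τ := by
  have h := resume_refCell hl (cellLoop_get i)
  rw [insert_of_lookup_eq_some hl] at h
  exact (APlus.call _ _ τ).trans h

theorem setV_run {l : Label} {i : ℕ} {τ : AStore} (hl : GetNum l τ i) (k : ℕ) :
    .conf (.app (.app (.force setV) (.lab l)) (num k)) τ ⟶⁺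
      .conf (.ret .unit) (τ.insert l (.full (refCell (num k)))) := by
  refine (APlus.call₂ _ _ _ τ).trans ?_
  simpa using resume_refCell hl (cellLoop_set i k)

theorem refV_run {l : Label} {τ : AStore} (hl : l ∉ τ) (k : ℕ) :
    .conf (.app (.force refV) (num k)) τ ⟶⁺
      .conf (.ret (.lab l)) (τ.insert l (.full (refCell (num k)))) := by
  refine (APlus.call _ _ τ).trans (ABeta.plus ?_)
  simpa [refCell] using ABeta.create (refCell (num k)) τ l hl

theorem incrV_run (i : ℕ) (τ : AStore) :
    .conf (.app (.force incrV) (num i)) τ ⟶⁺ .conf (.ret (num (i + 1))) τ :=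
  APlus.call _ _ τ

theorem compareStep_run (τ : AStore) : ∀ i j : ℕ,
    .conf (.app (.app (.app (.force compareStep) compareStep) (num i)) (num j)) τ ⟶⁺
      .conf (.ret (.inj (if i = j then tagTrue else tagFalse) .unit)) τ
  | 0, 0 | 0, _ + 1 | _ + 1, 0 => by
    refine (APlus.call₃ _ _ _ _ τ).trans ?_
    simp only [AComp.inst, AComp.sub, ABrs.sub, AVal.sub]
    refine (APlus.scase rfl rfl).trans ?_
    exact APlus.scase rfl rfl
  | i + 1, j + 1 => by
    have hstep : .conf (.app (.app (.app (.force compareStep) compareStep) (num (i + 1)))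
        (num (j + 1))) τ ⟶⁺
        .conf (.app (.app (.app (.force compareStep) compareStep) (num i)) (num j)) τ := by
      refine (APlus.call₃ _ _ _ _ τ).trans ?_
      simp only [AComp.inst, AComp.sub, ABrs.sub, AVal.sub]
      refine (APlus.scase rfl rfl).trans ?_
      simp only [AComp.inst, AComp.sub, ABrs.sub, AVal.sub]
      refine APlus.scase rfl ?_
      simp
    simpa using hstep.trans (compareStep_run τ i j)

theorem compareV_run (i j : ℕ) (τ : AStore) :
    .conf (.app (.app (.force compareV) (num i)) (num j)) τ ⟶⁺
      .conf (.ret (.inj (if i = j then tagTrue else tagFalse) .unit)) τ :=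
  (((ABeta.force _ τ).plus.app _).app _).trans (compareStep_run τ i j)

theorem failV_run (τ : AStore) : .conf (.force failV) τ ⟶⁺ .bot := by
  obtain ⟨z, hz⟩ := exists_notMem τ
  set τ' := τ.insert z (.full (.thunk (.lam (.ret .unit))))
  have hresume : .conf (.resume (.lab z) .unit) τ' ⟶⁺ .conf (.ret .unit) (τ'.insert z .nil) :=
    (APlus.resume (Finmap.lookup_insert _) rfl).trans (ABeta.ret z .unit _).plus
  calc AConf.conf (.force failV) τ
    _ ⟶⁺ .conf (.seq (.create (.thunk (.lam (.ret .unit))))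
          (.seq (.resume (.var 0) .unit) (.resume (.var 1) .unit))) τ := (ABeta.force _ τ).plus
    _ ⟶⁺ .conf (.seq (.resume (.lab z) .unit) (.resume (.lab z) .unit)) τ' :=
      .bind (ABeta.create _ τ z hz).plus rfl
    _ ⟶⁺ .conf (.resume (.lab z) .unit) (τ'.insert z .nil) := .bind hresume rfl
    _ ⟶⁺ .bot := (ABeta.fail z .unit _ (Finmap.lookup_insert _)).plus

/-! ### Runs of the macros -/

theorem dollarMacro_run (N₁ N₂ : AComp) {z zc : Label} {τ : AStore} (hz : z ∉ τ)
    (hzc : zc ∉ τ) (hne : zc ≠ z) :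
    .conf (dollarMacro N₁ N₂) τ ⟶⁺
      .conf (running z zc 0 N₁ N₂) ((τ.insert zc (.full (refCell (num 0)))).insert z .nil) := by
  have hcreate := (ABeta.create (.thunk (.lam ((coBody N₁ N₂).ren Nat.succ))) τ z hz).plus
  have href := refV_run (τ := τ.insert z (.full (.thunk (.lam ((coBody N₁ N₂).ren Nat.succ)))))
    (l := zc) (by simp [hzc, hne]) 0
  rw [Finmap.insert_insert_of_ne _ hne.symm] at href
  have hresume := APlus.resume (W := .unit) (Finmap.lookup_insert (a := z)
    (b := .full (.thunk (.lam ((coBody N₁ N₂).ren Nat.succ))))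
    (τ.insert zc (.full (refCell (num 0))))) (AComp.inst_ren_succ _ _)
  rw [Finmap.insert_insert] at hresume
  calc AConf.conf (dollarMacro N₁ N₂) τ
    _ ⟶⁺ .conf (.seq (.app (.force refV) (num 0)) (.seq (.resume (.lab z) .unit)
        (.app (.force (.var 0)) (.pair (.pair (.lab z) (.var 1)) (num 0))))) _ :=
      hcreate.bind (by simp)
    _ ⟶⁺ .conf (.seq (.resume (.lab z) .unit)
        (.app (.force (.var 0)) (triple (z, zc, 0)))) _ := href.bind (by simp [triple])
    _ ⟶⁺ .conf (running z zc 0 N₁ N₂) _ := hresume.seq _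

theorem running_return (m mc : Label) (i : ℕ) {N N' : AComp} {τ τ' : AStore}
    (h : .conf (.label m N) τ ⟶⁺ .conf (.ret (.thunk (.lam N'))) τ') :
    .conf (.seq (.label m N) (.app (.force (.var 0)) (triple (m, mc, i)))) τ ⟶⁺
      .conf (N'.inst (triple (m, mc, i))) τ' :=
  (h.bind (M' := .app (.force (.thunk (.lam N'))) (triple (m, mc, i))) (by simp)).trans
    (APlus.call _ _ _)

theorem running_ret (m mc : Label) (i : ℕ) (V : AVal) (N : AComp) (τ : AStore) :
    .conf (running m mc i (.ret V) N) τ ⟶⁺ .conf (N.inst V) τ := by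
  have hreturn : .conf (.label m (coBody (.ret V) N)) τ ⟶⁺
      .conf (.ret (.thunk (.lam ((N.inst V).ren Nat.succ)))) τ := by
    refine ((ABeta.seq V _ τ).plus.label m).trans ?_
    simpa [AComp.sub_up_ren_succ] using
      (ABeta.ret m (.thunk (.lam ((N.inst V).ren Nat.succ))) τ).plus
  rw [← AComp.inst_ren_succ (N.inst V) (triple (m, mc, i))]
  exact running_return m mc i hreturn

/-- The value that the coroutine of a delimiter with body `N` stores when it is suspended in the
pure context `K`. -/
abbrev captured (K : APCtx) (N : AComp) : AVal :=
  (APCtx.seq K (.ret (.thunk (.lam (N.ren Nat.succ))))).reify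

theorem running_yield (m mc : Label) (i : ℕ) (H : APCtx) (M N : AComp) (τ : AStore) :
    .conf (running m mc i (H.plug (.yield (.thunk (.lam M)))) N) τ ⟶⁺
      .conf (M.inst (triple (m, mc, i))) (τ.insert m (.full (captured H N))) :=
  running_return m mc i
    (ABeta.yield m (.seq H (.ret (.thunk (.lam (N.ren Nat.succ))))) _ τ).plus

theorem APCtx.inst_plug_ren_succ (H : APCtx) (W : AVal) :
    ((H.ren Nat.succ).plug (.ret (.var 0))).inst W = H.plug (.ret W) := by
  induction H with
  | hole => rfl
  | seq H N ih =>
    have hN : (N.ren (liftR Nat.succ)).sub (AVal.up (scons W AVal.var)) = N := by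
      rw [AComp.sub_ren, AVal.up_comp_liftR]
      exact (congrArg N.sub AVal.up_var).trans N.sub_var
    simp_all [APCtx.ren, APCtx.plug]
  | app H V ih => simp_all [APCtx.ren, APCtx.plug]
  | prj i H ih => simp_all [APCtx.ren, APCtx.plug]

/-- The continuation of the translation of a `throw` of `W` to `((z, zc), i)`, when the comparison
of `i` with the counter `zc` has had the result `b`. -/
def throwBranches (z zc : Label) (i : ℕ) (b W : AVal) : AComp :=
  .scase b
    (.cons tagTrue
      (.seq (.app (.force incrV) (num i))
        (.seq (.app (.app (.force setV) (.lab zc)) (.var 0))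
          (.seq (.resume (.lab z) (W.ren (· + 3)))
            (.app (.force (.var 0)) (.pair (.pair (.lab z) (.lab zc)) (.var 2))))))
    (.cons tagFalse (.force failV) .nil))

theorem throwMacro_compare {z zc : Label} {i j : ℕ} (W : AVal) {τ : AStore}
    (hc : GetNum zc τ j) :
    .conf (throwMacro (triple (z, zc, i)) W) τ ⟶⁺
      .conf (throwBranches z zc i (.inj (if i = j then tagTrue else tagFalse) .unit) W) τ := by
  have htriple : .conf (throwMacro (triple (z, zc, i)) W) τ ⟶⁺
      .conf (.seq (.app (.force getV) (.lab zc))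
        (.seq (.app (.app (.force compareV) (num i)) (.var 0))
          (throwBranches z zc i (.var 0) (W.ren (· + 2))))) τ := by
    refine (APlus.pcase rfl).trans ?_
    simp only [AComp.inst2, AComp.sub, AVal.sub]
    refine APlus.pcase ?_
    simp [throwBranches]
  calc AConf.conf (throwMacro (triple (z, zc, i)) W) τ
    _ ⟶⁺ .conf (.seq (.app (.force getV) (.lab zc))
        (.seq (.app (.app (.force compareV) (num i)) (.var 0))
          (throwBranches z zc i (.var 0) (W.ren (· + 2))))) τ := htriple
    _ ⟶⁺ .conf (.seq (.app (.app (.force compareV) (num i)) (num j))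
        (throwBranches z zc i (.var 0) (W.ren Nat.succ))) τ :=
      (getV_run hc).bind (by simp [throwBranches])
    _ ⟶⁺ .conf (throwBranches z zc i (.inj (if i = j then tagTrue else tagFalse) .unit) W) τ :=
      (compareV_run i j τ).bind (by simp [throwBranches])

theorem throwMacro_run {z zc : Label} {i : ℕ} (H : APCtx) (N : AComp) (W : AVal) {τ : AStore}
    (hc : GetNum zc τ i) (hne : zc ≠ z) (hz : τ.lookup z = some (.full (captured H N))) :
    .conf (throwMacro (triple (z, zc, i)) W) τ ⟶⁺
      .conf (running z zc (i + 1) (H.plug (.ret W)) N)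
        ((τ.insert zc (.full (refCell (num (i + 1))))).insert z .nil) := by
  have hresume : .conf (.resume (.lab z) W) (τ.insert zc (.full (refCell (num (i + 1))))) ⟶⁺
      .conf (.label z (coBody (H.plug (.ret W)) N))
        ((τ.insert zc (.full (refCell (num (i + 1))))).insert z .nil) :=
    APlus.resume (by rwa [Finmap.lookup_insert_of_ne _ hne.symm])
      (APCtx.inst_plug_ren_succ (.seq H (.ret (.thunk (.lam (N.ren Nat.succ))))) W)
  calc AConf.conf (throwMacro (triple (z, zc, i)) W) τ
    _ ⟶⁺ .conf (throwBranches z zc i (.inj tagTrue .unit) W) τ := by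
      simpa using throwMacro_compare (z := z) (i := i) W hc
    _ ⟶⁺ .conf (.seq (.app (.force incrV) (num i))
        (.seq (.app (.app (.force setV) (.lab zc)) (.var 0))
          (.seq (.resume (.lab z) (W.ren (· + 2)))
            (.app (.force (.var 0)) (.pair (.pair (.lab z) (.lab zc)) (.var 2)))))) τ :=
      .scase rfl (by simp)
    _ ⟶⁺ .conf (.seq (.app (.app (.force setV) (.lab zc)) (num (i + 1)))
        (.seq (.resume (.lab z) (W.ren Nat.succ))
          (.app (.force (.var 0)) (triple (z, zc, i + 1))))) τ :=
      (incrV_run i τ).bind (by simp [triple])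
    _ ⟶⁺ .conf (.seq (.resume (.lab z) W) (.app (.force (.var 0)) (triple (z, zc, i + 1)))) _ :=
      (setV_run hc (i + 1)).bind (by simp)
    _ ⟶⁺ .conf (running z zc (i + 1) (H.plug (.ret W)) N) _ := hresume.seq _

theorem throwMacro_fail {z zc : Label} {i j : ℕ} (W : AVal) {τ : AStore}
    (hc : GetNum zc τ j) (hij : i ≠ j) : .conf (throwMacro (triple (z, zc, i)) W) τ ⟶⁺ .bot :=
  calc AConf.conf (throwMacro (triple (z, zc, i)) W) τ
    _ ⟶⁺ .conf (throwBranches z zc i (.inj tagFalse .unit) W) τ := by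
      simpa [hij] using throwMacro_compare (z := z) (i := i) W hc
    _ ⟶⁺ .conf (.force failV) τ := .scase rfl rfl
    _ ⟶⁺ .bot := failV_run τ

end

/-! ### Well-formed configurations -/

theorem AComp.WF.of_active_eq_empty {N : AComp} (h : N.active = ∅) : N.WF := by
  induction N using AComp.rec (motive_1 := fun _ => True) (motive_3 := fun _ => True) with
  | pcase _ _ => exact .pcase h
  | scase _ _ => exact .scase h
  | force _ => exact .force h
  | ret _ => exact .ret h
  | seq _ _ ih _ => exact .seq (ih (Set.union_empty_iff.1 h).1) (Set.union_empty_iff.1 h).2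
  | lam _ => exact .lam h
  | app _ _ ih _ => exact .app (ih (Set.union_empty_iff.1 h).1) (Set.union_empty_iff.1 h).2
  | cpair _ _ => exact .cpair h
  | prj _ _ ih => exact .prj (ih h)
  | label l M _ => exact absurd h (Set.insert_nonempty l M.active).ne_empty
  | create _ => exact .create h
  | resume _ _ => exact .resume h
  | yield _ => exact .yield h
  | _ => trivial

/-- The active labels of an evaluation context of `AC`. -/
def ACtx.active : ACtx → Set Label
  | .hole => ∅
  | .seq D N => D.active ∪ N.active
  | .app D V => D.active ∪ V.active
  | .prj _ D => D.active
  | .label l D => insert l D.active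

theorem ACtx.active_plug (D : ACtx) (N : AComp) : (D.plug N).active = D.active ∪ N.active := by
  induction D with
  | hole => exact (Set.empty_union _).symm
  | seq D N ih | app D V ih => simp only [plug, active, AComp.active, ih, Set.union_right_comm]
  | prj _ _ ih => exact ih
  | label l D ih => simp only [plug, active, AComp.active, ih, Set.insert_eq, Set.union_assoc]

theorem AComp.WF.disjoint_active {D : ACtx} {N : AComp} (h : (D.plug N).WF) :
    Disjoint D.active N.active := by
  induction D with
  | hole => exact Set.empty_disjoint _
  | seq D N ih =>
    cases h with | seq h hN => rw [ACtx.active, hN, Set.union_empty]; exact ih h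
  | app D V ih =>
    cases h with | app h hV => rw [ACtx.active, hV, Set.union_empty]; exact ih h
  | prj i D ih => cases h with | prj h => exact ih h
  | label l D ih =>
    cases h with
    | label h hl =>
      rw [ACtx.active_plug] at hl
      exact Set.disjoint_insert_left.2 ⟨fun hN => hl (.inr hN), ih h⟩

theorem AComp.WF.plug {D : ACtx} {N N' : AComp} (h : (D.plug N).WF) (hN' : N'.WF)
    (hd : Disjoint D.active N'.active) : (D.plug N').WF := by
  induction D with
  | hole => exact hN'
  | seq D N ih =>
    cases h with | seq h hN => exact .seq (ih h (hd.mono_left Set.subset_union_left)) hN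
  | app D V ih =>
    cases h with | app h hV => exact .app (ih h (hd.mono_left Set.subset_union_left)) hV
  | prj i D ih => cases h with | prj h => exact .prj (ih h hd)
  | label l D ih =>
    cases h with
    | label h hl =>
      rw [ACtx.active_plug] at hl
      obtain ⟨hlN', hd⟩ := Set.disjoint_insert_left.1 hd
      exact .label (ih h hd) (by rw [ACtx.active_plug]; exact fun h => h.elim (hl ∘ .inl) hlN')

/-- No value stored in `τ` has active labels: the condition on the store in `WellFormed`. -/
def StoreInactive (τ : AStore) : Prop := ∀ l V, τ.lookup l = some (.full V) → V.active = ∅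

section

variable {τ τ' : AStore} {N N' : AComp} {l : Label}

theorem StoreInactive.insert_full (h : StoreInactive τ) {V : AVal} (hV : V.active = ∅) :
    StoreInactive (τ.insert l (.full V)) := by
  intro m W hm
  by_cases hml : m = l
  · subst hml
    rw [Finmap.lookup_insert] at hm
    cases hm
    exact hV
  · exact h m W (by rwa [Finmap.lookup_insert_of_ne _ hml] at hm)

theorem StoreInactive.insert_nil (h : StoreInactive τ) : StoreInactive (τ.insert l .nil) := by
  intro m W hm
  by_cases hml : m = l
  · subst hml
    rw [Finmap.lookup_insert] at hm
    cases hm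
  · exact h m W (by rwa [Finmap.lookup_insert_of_ne _ hml] at hm)

theorem WellFormed.of_active_eq_empty (hN : N.active = ∅) (hτ : StoreInactive τ) :
    WellFormed N τ :=
  ⟨.of_active_eq_empty hN, hτ, by simp [hN]⟩

theorem WellFormed.lookup_eq_nil {D : ACtx} (h : WellFormed (D.plug N) τ) (hl : l ∈ D.active) :
    τ.lookup l = some .nil :=
  h.active_nil l (D.active_plug N ▸ .inl hl)

theorem WellFormed.plug {D : ACtx} (h : WellFormed (D.plug N) τ) (hN' : WellFormed N' τ')
    (hd : Disjoint D.active N'.active) (hτ' : ∀ l ∈ D.active, τ'.lookup l = some .nil) :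
    WellFormed (D.plug N') τ' where
  comp := h.comp.plug hN'.comp hd
  store := hN'.store
  active_nil l hl := by
    rw [ACtx.active_plug] at hl
    exact hl.elim (hτ' l) (hN'.active_nil l)

theorem DPCtx.active_plug_ren_tr (η : Env) (H : DPCtx) (ρ : ℕ → ℕ) (N : AComp) :
    (((H.tr η).ren ρ).plug N).active = N.active := by
  induction H with
  | hole => rfl
  | seq _ _ ih =>
    simp [DPCtx.tr, APCtx.ren, APCtx.plug, AComp.active, AComp.active_ren, DComp.active_tr, ih]
  | app _ _ ih =>
    simp [DPCtx.tr, APCtx.ren, APCtx.plug, AComp.active, AVal.active_ren, DVal.active_tr, ih]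
  | prj _ _ ih => exact ih

theorem captured_active_tr (η : Env) (H : DPCtx) (K : DComp) :
    (captured (H.tr η) (K.tr η)).active = ∅ := by
  simp [APCtx.reify, APCtx.ren, APCtx.plug, AVal.active, AComp.active, AComp.active_ren,
    DComp.active_tr, DPCtx.active_plug_ren_tr]

theorem running_active (m mc : Label) (i : ℕ) (N₁ N₂ : AComp) :
    (running m mc i N₁ N₂).active = insert m (N₁.active ∪ N₂.active) := by
  simp [running, coBody_active, AComp.active, AVal.active]

theorem WellFormed.running {mc : Label} {i : ℕ} (hN : N.active = ∅) (hN' : N'.active = ∅)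
    (hτ : StoreInactive τ) (hl : τ.lookup l = some .nil) :
    WellFormed (running l mc i N N') τ where
  comp := .seq (.label (.of_active_eq_empty (by simp [coBody_active, hN, hN']))
    (by simp [coBody_active, hN, hN']))
    (by simp [AComp.active, AVal.active])
  store := hτ
  active_nil := by simpa [running_active, hN, hN'] using hl

end

/-! ### Partial maps and counters -/

/-- The partial function `g` extends `f`; used for growing `η` and `κ`. -/
def IsSubmap {α β : Type*} (f g : α → Option β) : Prop := ∀ ⦃a b⦄, f a = some b → g a = some b

section

variable {α β : Type} {f g : α → Option β} {η η' : Env}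

theorem IsSubmap.refl (f : α → Option β) : IsSubmap f f := fun _ _ h => h

theorem IsSubmap.pdom_subset (h : IsSubmap f g) : pdom f ⊆ pdom g :=
  fun _ ⟨b, hb⟩ => ⟨b, h hb⟩

theorem IsSubmap.eqOn (h : IsSubmap f g) : Set.EqOn f g (pdom f) :=
  fun _ ⟨_, hb⟩ => hb.trans (h hb).symm

variable [DecidableEq α]

theorem pdom_update (f : α → Option β) (a : α) (b : β) :
    pdom (Function.update f a (some b)) = insert a (pdom f) := by
  ext x
  by_cases hx : x = a
  · subst hx
    simp [pdom]
  · simp [pdom, hx]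

theorem isSubmap_update {a : α} (ha : a ∉ pdom f) (b : β) :
    IsSubmap f (Function.update f a (some b)) := by
  intro x c hx
  rwa [Function.update_of_ne]
  rintro rfl
  exact ha ⟨c, hx⟩

theorem pim_update {a : α} (ha : a ∉ pdom f) (b : β) :
    pim (Function.update f a (some b)) = insert b (pim f) := by
  ext c
  constructor
  · rintro ⟨x, hx⟩
    by_cases hxa : x = a
    · subst hxa
      rw [Function.update_self] at hx
      exact .inl (Option.some.inj hx).symm
    · rw [Function.update_of_ne hxa] at hx
      exact .inr ⟨x, hx⟩
  · rintro (rfl | ⟨x, hx⟩)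
    · exact ⟨a, Function.update_self ..⟩
    · exact ⟨x, isSubmap_update ha b hx⟩

theorem TrVal.mono {V : DVal} {W : AVal} (h : TrVal η V W) (hη : IsSubmap η η') : TrVal η' V W :=
  ⟨h.1.trans hη.pdom_subset, h.2.trans (DVal.tr_congr (hη.eqOn.mono h.1))⟩

theorem TrComp.mono {M : DComp} {N : AComp} (h : TrComp η M N) (hη : IsSubmap η η') :
    TrComp η' M N :=
  ⟨h.1.trans hη.pdom_subset, h.2.trans (DComp.tr_congr (hη.eqOn.mono h.1))⟩

theorem TrPCtx.mono {H : DPCtx} {K : APCtx} (h : TrPCtx η H K) (hη : IsSubmap η η') :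
    TrPCtx η' H K :=
  ⟨h.1.trans hη.pdom_subset, h.2.trans (DPCtx.tr_congr (hη.eqOn.mono h.1))⟩

end

theorem num_injective : Function.Injective num := by
  intro i
  induction i with
  | zero => intro j h; cases j <;> simp_all [num, tagZero, tagSucc]
  | succ i ih =>
    intro j h
    cases j with
    | zero => simp [num, tagZero, tagSucc] at h
    | succ j => simp only [num, AVal.inj.injEq, true_and] at h; rw [ih h]

theorem GetNum.unique {l : Label} {τ : AStore} {i j : ℕ} (hi : GetNum l τ i)
    (hj : GetNum l τ j) : i = j := by
  have h := hi.symm.trans hj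
  simp only [refCell, num_ren, Option.some.injEq, Slot.full.injEq, AVal.thunk.injEq,
    AComp.lam.injEq, AComp.seq.injEq, AComp.app.injEq, true_and, and_true] at h
  exact num_injective h

theorem GetNum.insert_self (l : Label) (τ : AStore) (i : ℕ) :
    GetNum l (τ.insert l (.full (refCell (num i)))) i :=
  Finmap.lookup_insert _

theorem GetNum.insert {l m : Label} {τ : AStore} {i : ℕ} (h : GetNum l τ i) (hlm : l ≠ m)
    (s : Slot AVal) : GetNum l (τ.insert m s) i := by
  rwa [GetNum, Finmap.lookup_insert_of_ne _ hlm]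

theorem setOf_mem_insert {α : Type*} {β : α → Type*} [DecidableEq α] (s : Finmap β) (a : α)
    (b : β a) : {x | x ∈ s.insert a b} = insert a {x | x ∈ s} := by
  ext x
  simp

theorem setOf_mem_insert_of_mem {α : Type*} {β : α → Type*} [DecidableEq α] {s : Finmap β} {a : α}
    (ha : a ∈ s) (b : β a) : {x | x ∈ s.insert a b} = {x | x ∈ s} := by
  rw [setOf_mem_insert, Set.insert_eq_of_mem (show a ∈ {x | x ∈ s} from ha)]

/-! ### The invariant -/

/-- The labels of `τ` are partitioned into coroutines and counters by the bijection `κ`. -/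
structure IsCounterMap (κ : Label → Option Label) (τ : AStore) : Prop where
  inj : ∀ m m' c, κ m = some c → κ m' = some c → m = m'
  disjoint : pdom κ ∩ pim κ = ∅
  dom : pdom κ ∪ pim κ = {l | l ∈ τ}

section

variable {κ : Label → Option Label} {τ : AStore} {z zc : Label}

theorem IsCounterMap.mem (h : IsCounterMap κ τ) (hz : κ z = some zc) : z ∈ τ :=
  h.dom.subset (.inl ⟨zc, hz⟩)

theorem IsCounterMap.counter_mem (h : IsCounterMap κ τ) (hz : κ z = some zc) : zc ∈ τ :=
  h.dom.subset (.inr ⟨z, hz⟩)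

theorem IsCounterMap.ne (h : IsCounterMap κ τ) {m mc : Label} (hz : κ z = some zc)
    (hm : κ m = some mc) : mc ≠ z := by
  rintro rfl
  exact h.disjoint.subset ⟨⟨zc, hz⟩, ⟨m, hm⟩⟩

theorem IsCounterMap.insert (h : IsCounterMap κ τ) {l : Label} (hl : l ∈ τ) (s : Slot AVal) :
    IsCounterMap κ (τ.insert l s) where
  __ := h
  dom := by rw [setOf_mem_insert_of_mem hl, h.dom]

theorem IsCounterMap.update (h : IsCounterMap κ τ) (hz : z ∉ τ) (hzc : zc ∉ τ) (hne : zc ≠ z)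
    (s s' : Slot AVal) :
    IsCounterMap (Function.update κ z (some zc)) ((τ.insert zc s).insert z s') := by
  have hzκ : z ∉ pdom κ := fun h' => hz (h.dom.subset (.inl h'))
  have hzκ' : z ∉ pim κ := fun h' => hz (h.dom.subset (.inr h'))
  have hzcκ : zc ∉ pdom κ := fun h' => hzc (h.dom.subset (.inl h'))
  have hzcκ' : zc ∉ pim κ := fun h' => hzc (h.dom.subset (.inr h'))
  refine ⟨fun m m' c hm hm' => ?_, ?_, ?_⟩
  · simp only [Function.update_apply] at hm hm'
    split_ifs at hm hm' with hmz hmz' hmz'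
    · rw [hmz, hmz']
    · exact absurd ⟨m', hm'.trans hm.symm⟩ hzcκ'
    · exact absurd ⟨m, hm.trans hm'.symm⟩ hzcκ'
    · exact h.inj m m' c hm hm'
  · rw [pdom_update, pim_update hzκ, Set.insert_inter_of_notMem (by simp [hne.symm, hzκ']),
      Set.inter_insert_of_notMem hzcκ, h.disjoint]
  · rw [pdom_update, pim_update hzκ, setOf_mem_insert, setOf_mem_insert, ← h.dom,
      Set.insert_union, Set.union_insert]

end

/-- The data on which the simulation relation depends besides the two computations. -/
structure State where
  /-- The triples that represent the labels of `DEL_one`. -/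
  η : Env
  /-- The counters of the coroutines. -/
  κ : Label → Option Label
  /-- The store of `DEL_one`. -/
  θ : DStore
  /-- The store of `AC`. -/
  τ : AStore

/-- The conditions that `IC` imposes on a label `l` with `η l = (z, zc, i)`. -/
structure LabelInv (s : State) (l z zc : Label) (i : ℕ) : Prop where
  used : s.θ.lookup l = some .nil → ∃ j, GetNum zc s.τ j ∧ i < j
  live : ∀ H M, s.θ.lookup l = some (.full ⟨H, M⟩) →
    l ∉ M.labels ∧
    GetNum zc s.τ i ∧
    (∀ l' ∈ s.θ, l' ≠ l → ∀ zc' i', s.η l' = some (z, zc', i') → s.θ.lookup l' = some .nil) ∧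
    ∃ K N, TrPCtx s.η H K ∧ TrComp s.η M N ∧ s.τ.lookup z = some (.full (captured K N))

/-- The coroutine `m` with counter `mc = κ m`, whose value is `i`, is running: the side conditions
of `Rel.running`. -/
structure IsRunning (s : State) (m mc : Label) (i : ℕ) : Prop where
  kappa : s.κ m = some mc
  count : GetNum mc s.τ i
  lookup : s.τ.lookup m = some .nil
  used : ∀ l j, s.η l = some (m, mc, j) → s.θ.lookup l = some .nil

/-- `s'` arises from `s` by a change that concerns only the coroutine `z` (which may be new), its
counter `zc`, and the labels of `DEL_one` represented by a triple with first component `z`. -/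
structure LocalUpdate (z zc : Label) (s s' : State) : Prop where
  env : IsSubmap s.η s'.η
  counter : IsSubmap s.κ s'.κ
  counterMap : IsCounterMap s'.κ s'.τ
  kappa : s'.κ z = some zc
  lookup : ∀ a, a ≠ z → a ≠ zc → s'.τ.lookup a = s.τ.lookup a
  label : ∀ l m mc i, m ≠ z → s'.η l = some (m, mc, i) →
    s.η l = some (m, mc, i) ∧ s'.θ.lookup l = s.θ.lookup l

section

variable {s s' : State} {z zc m mc l : Label} {i : ℕ}

theorem IC.counterMap (h : IC s.θ s.τ s.η s.κ) : IsCounterMap s.κ s.τ :=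
  ⟨h.kappa_inj, h.kappa_disjoint, h.kappa_dom⟩

theorem IC.labelInv (h : IC s.θ s.τ s.η s.κ) (hl : s.η l = some (z, zc, i)) :
    LabelInv s l z zc i :=
  ⟨h.used l z zc i hl, fun H M => h.live l z zc i H M hl⟩

theorem LocalUpdate.lookup_coroutine (h : LocalUpdate z zc s s') (hm : m ≠ z)
    (hmc : s.κ m = some mc) : s'.τ.lookup m = s.τ.lookup m :=
  h.lookup m hm (h.counterMap.ne (h.counter hmc) h.kappa).symm

theorem LocalUpdate.lookup_counter (h : LocalUpdate z zc s s') (hm : m ≠ z)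
    (hmc : s.κ m = some mc) : s'.τ.lookup mc = s.τ.lookup mc :=
  h.lookup mc (h.counterMap.ne h.kappa (h.counter hmc))
    fun hc => hm (h.counterMap.inj m z zc (hc ▸ h.counter hmc) h.kappa)

theorem LocalUpdate.getNum (h : LocalUpdate z zc s s') (hm : m ≠ z) (hmc : s.κ m = some mc)
    (hi : GetNum mc s.τ i) : GetNum mc s'.τ i :=
  (h.lookup_counter hm hmc).trans hi

theorem IsRunning.frame (h : IsRunning s m mc i) (hs : LocalUpdate z zc s s') (hm : m ≠ z) :
    IsRunning s' m mc i where
  kappa := hs.counter h.kappa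
  count := hs.getNum hm h.kappa h.count
  lookup := (hs.lookup_coroutine hm h.kappa).trans h.lookup
  used l j hl := by
    obtain ⟨hl, hθ⟩ := hs.label l m mc j hm hl
    exact hθ.trans (h.used l j hl)

theorem LabelInv.frame (h : LabelInv s l m mc i) (hs : LocalUpdate z zc s s') (hm : m ≠ z)
    (hmc : s.κ m = some mc) (hθ : s'.θ.lookup l = s.θ.lookup l)
    (hdom : ∀ l ∈ pdom s.η, l ∈ s.θ) : LabelInv s' l m mc i where
  used hl := by
    obtain ⟨j, hj, hij⟩ := h.used (hθ ▸ hl)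
    exact ⟨j, hs.getNum hm hmc hj, hij⟩
  live H M hl := by
    obtain ⟨hlM, hi, hothers, K, N, hK, hN, hz⟩ := h.live H M (hθ ▸ hl)
    refine ⟨hlM, hs.getNum hm hmc hi, fun l' _ hne mc' i' hl' => ?_, K, N, hK.mono hs.env,
      hN.mono hs.env, (hs.lookup_coroutine hm hmc).trans hz⟩
    obtain ⟨hl', hθ'⟩ := hs.label l' m mc' i' hm hl'
    exact hθ'.trans (hothers l' (hdom l' ⟨_, hl'⟩) hne mc' i' hl')

theorem IC.frame (h : IC s.θ s.τ s.η s.κ) (hs : LocalUpdate z zc s s')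
    (hdom : pdom s'.η = {l | l ∈ s'.θ})
    (hz : ∀ l zc' i, s'.η l = some (z, zc', i) → zc' = zc ∧ LabelInv s' l z zc i) :
    IC s'.θ s'.τ s'.η s'.κ := by
  have hlabel : ∀ l m mc i, s'.η l = some (m, mc, i) → s'.κ m = some mc ∧ LabelInv s' l m mc i := by
    intro l m mc i hl
    by_cases hm : m = z
    · subst hm
      obtain ⟨rfl, hinv⟩ := hz l mc i hl
      exact ⟨hs.kappa, hinv⟩
    · obtain ⟨hl, hθ⟩ := hs.label l m mc i hm hl
      have hκ := h.eta_kappa l m mc i hl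
      exact ⟨hs.counter hκ, (h.labelInv hl).frame hs hm hκ hθ h.eta_dom.subset⟩
  exact ⟨hs.counterMap.inj, hs.counterMap.disjoint, hs.counterMap.dom, hdom,
    fun l m mc i hl => (hlabel l m mc i hl).1, fun l m mc i hl => (hlabel l m mc i hl).2.used,
    fun l m mc i H M hl => (hlabel l m mc i hl).2.live H M⟩

end

/-! ### Related evaluation contexts -/

/-- The context of a running delimiter: `D.running m mc i N` plugged with `M` is
`running m mc i (D.plug M) N`. -/
def ACtx.running (m mc : Label) (i : ℕ) (D : ACtx) (N : AComp) : ACtx :=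
  .seq (.label m (.seq D (.ret (.thunk (.lam (N.ren Nat.succ))))))
    (.app (.force (.var 0)) (triple (m, mc, i)))

/-- The relation of `Rel` for evaluation contexts all of whose delimiters are running. -/
inductive CtxRel (s : State) : DCtx → ACtx → Prop
  | hole : CtxRel s .hole .hole
  | seq {C D M N} : CtxRel s C D → TrComp s.η M N → CtxRel s (.seq C M) (.seq D N)
  | app {C D V W} : CtxRel s C D → TrVal s.η V W → CtxRel s (.app C V) (.app D W)
  | prj {C D i} : CtxRel s C D → CtxRel s (.prj i C) (.prj i D)
  | running {C D M N m mc i} : CtxRel s C D → TrComp s.η M N → IsRunning s m mc i →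
      CtxRel s (.dollar C M) (.running m mc i D N)

/-- The composition `C[E[ ]]` of evaluation contexts of `DEL_one`. -/
def DCtx.comp : DCtx → DCtx → DCtx
  | .hole, E => E
  | .seq C N, E => .seq (C.comp E) N
  | .app C V, E => .app (C.comp E) V
  | .prj i C, E => .prj i (C.comp E)
  | .dollar C N, E => .dollar (C.comp E) N

theorem DCtx.comp_hole (C : DCtx) : C.comp .hole = C := by
  induction C <;> simp only [comp, *]

theorem DCtx.comp_assoc (C₁ C₂ C₃ : DCtx) : (C₁.comp C₂).comp C₃ = C₁.comp (C₂.comp C₃) := by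
  induction C₁ <;> simp only [comp, *]

section

variable {s s' : State} {C C' : DCtx} {D D' : ACtx} {M : DComp} {N N' : AComp}
  {m mc z zc : Label} {i : ℕ}

theorem ACtx.mem_active_running {l : Label} {N : AComp} (hN : N.active = ∅) :
    l ∈ (D.running m mc i N).active ↔ l = m ∨ l ∈ D.active := by
  simp [ACtx.running, ACtx.active, AComp.active, AVal.active, AComp.active_ren, hN]

theorem Rel.of_tr {η : Env} {κ : Label → Option Label} {θ : DStore} {τ : AStore} :
    ∀ {M : DComp}, M.labels ⊆ pdom η → Rel η κ θ τ M (M.tr η)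
  | .pcase _ _, h => .pcase ⟨h, rfl⟩
  | .scase _ _, h => .scase ⟨h, rfl⟩
  | .force _, h => .force ⟨h, rfl⟩
  | .ret _, h => .ret ⟨h, rfl⟩
  | .seq _ _, h => .seq (.of_tr (Set.union_subset_iff.1 h).1) ⟨(Set.union_subset_iff.1 h).2, rfl⟩
  | .lam _, h => .lam ⟨h, rfl⟩
  | .app _ _, h => .app (.of_tr (Set.union_subset_iff.1 h).1) ⟨(Set.union_subset_iff.1 h).2, rfl⟩
  | .cpair _ _, h => .cpair ⟨h, rfl⟩
  | .prj _ M, h => .prj (.of_tr (M := M) h)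
  | .shift _, h => .shift ⟨h, rfl⟩
  | .dollar _ _, h => .dollar ⟨h, rfl⟩
  | .throw _ _, h => .throw ⟨h, rfl⟩

/-- No dollar term occurs in an evaluation position, so that `Rel` is the translation. -/
def DComp.Undelimited : DComp → Prop
  | .seq M _ => M.Undelimited
  | .app M _ => M.Undelimited
  | .prj _ M => M.Undelimited
  | .dollar _ _ => False
  | _ => True

theorem DPCtx.undelimited_plug (H : DPCtx) (hM : M.Undelimited) : (H.plug M).Undelimited := by
  induction H <;> assumption

theorem Rel.trComp {η : Env} {κ : Label → Option Label} {θ : DStore} {τ : AStore}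
    (h : Rel η κ θ τ M N) (hM : M.Undelimited) : TrComp η M N := by
  induction h with
  | seq _ hN ih =>
    obtain ⟨hlab, rfl⟩ := ih hM
    exact ⟨Set.union_subset hlab hN.1, by rw [hN.2, DComp.tr]⟩
  | app _ hV ih =>
    obtain ⟨hlab, rfl⟩ := ih hM
    exact ⟨Set.union_subset hlab hV.1, by rw [hV.2, DComp.tr]⟩
  | prj _ ih =>
    obtain ⟨hlab, rfl⟩ := ih hM
    exact ⟨hlab, by rw [DComp.tr]⟩
  | dollar | running => exact hM.elim
  | _ => assumption

theorem CtxRel.plug (h : CtxRel s C D) (hM : Rel s.η s.κ s.θ s.τ M N) :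
    Rel s.η s.κ s.θ s.τ (C.plug M) (D.plug N) := by
  induction h with
  | hole => exact hM
  | seq _ hN ih => exact .seq ih hN
  | app _ hV ih => exact .app ih hV
  | prj _ ih => exact .prj ih
  | running _ hN hm ih => exact .running ih hN hm.kappa hm.count hm.lookup hm.used

theorem CtxRel.comp (h : CtxRel s C D) (h' : CtxRel s C' D') :
    CtxRel s (C.comp C') (D.comp D') := by
  induction h with
  | hole => exact h'
  | seq _ hN ih => exact .seq ih hN
  | app _ hV ih => exact .app ih hV
  | prj _ ih => exact .prj ih
  | running _ hN hm ih => exact .running ih hN hm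

theorem CtxRel.isRunning (h : CtxRel s C D) (hm : m ∈ D.active) :
    ∃ mc i, IsRunning s m mc i := by
  induction h with
  | hole => exact hm.elim
  | seq _ hN ih => exact ih (by simpa [ACtx.active, hN.2, DComp.active_tr] using hm)
  | app _ hV ih => exact ih (by simpa [ACtx.active, hV.2, DVal.active_tr] using hm)
  | prj _ ih => exact ih hm
  | running _ hN hrun ih =>
    rcases (ACtx.mem_active_running (hN.2 ▸ DComp.active_tr ..)).1 hm with rfl | hm
    · exact ⟨_, _, hrun⟩
    · exact ih hm

theorem CtxRel.frame (h : CtxRel s C D) (hs : LocalUpdate z zc s s') (hz : z ∉ D.active) :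
    CtxRel s' C D := by
  induction h with
  | hole => exact .hole
  | seq _ hN ih => exact .seq (ih (hz ∘ .inl)) (hN.mono hs.env)
  | app _ hV ih => exact .app (ih (hz ∘ .inl)) (hV.mono hs.env)
  | prj _ ih => exact .prj (ih hz)
  | running _ hN hrun ih =>
    rw [ACtx.mem_active_running (hN.2 ▸ DComp.active_tr ..), not_or] at hz
    exact .running (ih hz.2) (hN.mono hs.env) (hrun.frame hs (Ne.symm hz.1))

/-- The two machines are about to evaluate `M` and `N` in the contexts `C` and `D`, all delimiters
around the focus being running coroutines. -/
structure Focused (s : State) (C : DCtx) (D : ACtx) (M : DComp) (N : AComp) : Prop where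
  ctx : CtxRel s C D
  rel : Rel s.η s.κ s.θ s.τ M N
  wf : WellFormed (D.plug N) s.τ
  inv : IC s.θ s.τ s.η s.κ

theorem Focused.sim (h : Focused s C D M N) :
    Sim (.conf (C.plug M) s.θ) (.conf (D.plug N) s.τ) :=
  .inr ⟨_, _, s.θ, s.τ, s.η, s.κ, rfl, rfl, h.ctx.plug h.rel, h.wf, h.inv⟩

theorem Focused.enter (h : Focused s C D (C'.plug M) (D'.plug N)) (hctx : CtxRel s C' D')
    (hrel : Rel s.η s.κ s.θ s.τ M N) : Focused s (C.comp C') (D.comp D') M N where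
  ctx := h.ctx.comp hctx
  rel := hrel
  wf := by rw [ACtx.plug_comp]; exact h.wf
  inv := h.inv

theorem Focused.translate (h : Focused s C D M N) {M' : DComp} (hM' : M'.labels ⊆ pdom s.η) :
    Focused s C D M' (M'.tr s.η) where
  ctx := h.ctx
  rel := .of_tr hM'
  wf := h.wf.plug (.of_active_eq_empty (M'.active_tr s.η) h.wf.store)
    (by rw [DComp.active_tr]; exact Set.disjoint_empty _) fun _ => h.wf.lookup_eq_nil
  inv := h.inv

theorem Focused.update (h : Focused s C D M N) (hs : LocalUpdate z zc s s') (hz : z ∉ D.active)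
    (hdom : pdom s'.η = {l | l ∈ s'.θ})
    (hinv : ∀ l zc' i, s'.η l = some (z, zc', i) → zc' = zc ∧ LabelInv s' l z zc i)
    {M' : DComp} (hN' : WellFormed N' s'.τ) (hactive : N'.active ⊆ {z})
    (hrel : Rel s'.η s'.κ s'.θ s'.τ M' N') : Focused s' C D M' N' where
  ctx := h.ctx.frame hs hz
  rel := hrel
  wf := by
    refine h.wf.plug hN' ((Set.disjoint_singleton_right.2 hz).mono_right hactive) fun m hm => ?_
    obtain ⟨mc, i, hrun⟩ := h.ctx.isRunning hm
    exact (hrun.frame hs (by rintro rfl; exact hz hm)).lookup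
  inv := h.inv.frame hs hdom hinv

end

/-! ### Changes of the state -/

/-- The state after the creation of a coroutine `z` with counter `zc`, which starts running. -/
def State.create (s : State) (z zc : Label) : State :=
  { s with
    κ := Function.update s.κ z (some zc)
    τ := (s.τ.insert zc (.full (refCell (num 0)))).insert z .nil }

/-- The state after the coroutine `z` with counter `zc`, whose value is `i`, has been suspended by
the capture of the continuation `⟨H, K⟩` under the label `l`. -/
def State.capture (s : State) (z zc : Label) (i : ℕ) (l : Label) (H : DPCtx) (K : DComp) : State :=
  { s with
    η := Function.update s.η l (some (z, zc, i))
    θ := s.θ.insert l (.full ⟨H, K⟩)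
    τ := s.τ.insert z (.full (captured (H.tr s.η) (K.tr s.η))) }

/-- The state after the continuation `l`, represented by `((z, zc), i)`, has been used up and the
coroutine `z` has been resumed. -/
def State.consume (s : State) (z zc : Label) (i : ℕ) (l : Label) : State :=
  { s with
    θ := s.θ.insert l .nil
    τ := (s.τ.insert zc (.full (refCell (num (i + 1))))).insert z .nil }

section

variable {s : State} {z zc l : Label} {i : ℕ}

theorem State.capture_eta (s : State) (z zc : Label) (i : ℕ) (l : Label) (H : DPCtx) (K : DComp) :
    (s.capture z zc i l H K).η l = some (z, zc, i) :=
  Function.update_self ..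

theorem State.capture_eta_of_ne (s : State) (z zc : Label) (i : ℕ) {l l' : Label} (hl' : l' ≠ l)
    (H : DPCtx) (K : DComp) : (s.capture z zc i l H K).η l' = s.η l' :=
  Function.update_of_ne hl' ..

theorem LocalUpdate.create (h : IC s.θ s.τ s.η s.κ) (hz : z ∉ s.τ) (hzc : zc ∉ s.τ)
    (hne : zc ≠ z) : LocalUpdate z zc s (s.create z zc) where
  env := .refl _
  counter := isSubmap_update (fun ⟨_, hκ⟩ => hz (h.counterMap.mem hκ)) zc
  counterMap := h.counterMap.update hz hzc hne _ _
  kappa := Function.update_self ..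
  lookup _ hm hm' :=
    (Finmap.lookup_insert_of_ne _ hm).trans (Finmap.lookup_insert_of_ne _ hm')
  label _ _ _ _ _ hl := ⟨hl, rfl⟩

theorem LocalUpdate.capture (h : IC s.θ s.τ s.η s.κ) (hz : s.κ z = some zc) (hl : l ∉ s.θ)
    (i : ℕ) (H : DPCtx) (K : DComp) : LocalUpdate z zc s (s.capture z zc i l H K) where
  env := isSubmap_update (fun hl' => hl (h.eta_dom.subset hl')) _
  counter := .refl _
  counterMap := h.counterMap.insert (h.counterMap.mem hz) _
  kappa := hz
  lookup _ hm _ := Finmap.lookup_insert_of_ne _ hm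
  label l' m mc j hm hl' := by
    have hne : l' ≠ l := by
      rintro rfl
      rw [State.capture_eta] at hl'
      cases hl'
      exact hm rfl
    exact ⟨(s.capture_eta_of_ne z zc i hne H K).symm.trans hl', Finmap.lookup_insert_of_ne _ hne⟩

theorem LocalUpdate.consume (h : IC s.θ s.τ s.η s.κ) (hl : s.η l = some (z, zc, i)) :
    LocalUpdate z zc s (s.consume z zc i l) where
  env := .refl _
  counter := .refl _
  counterMap := by
    have hz := h.eta_kappa l z zc i hl
    refine (h.counterMap.insert (h.counterMap.counter_mem hz) _).insert ?_ _
    exact Finmap.mem_insert.2 (.inr (h.counterMap.mem hz))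
  kappa := h.eta_kappa l z zc i hl
  lookup _ hm hm' :=
    (Finmap.lookup_insert_of_ne _ hm).trans (Finmap.lookup_insert_of_ne _ hm')
  label l' m mc j hm hl' := by
    refine ⟨hl', Finmap.lookup_insert_of_ne _ ?_⟩
    rintro rfl
    cases hl.symm.trans hl'
    exact hm rfl

theorem IC.eta_ne (h : IC s.θ s.τ s.η s.κ) (hz : z ∉ s.τ) (l zc : Label) (i : ℕ) :
    s.η l ≠ some (z, zc, i) :=
  fun hl => hz (h.counterMap.mem (h.eta_kappa l z zc i hl))

theorem IsRunning.create (h : IC s.θ s.τ s.η s.κ) (hz : z ∉ s.τ) (hne : zc ≠ z) :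
    IsRunning (s.create z zc) z zc 0 where
  kappa := Function.update_self ..
  count := (GetNum.insert_self ..).insert hne _
  lookup := Finmap.lookup_insert _
  used l j hl := absurd hl (h.eta_ne hz l zc j)

theorem LabelInv.of_used {j : ℕ} (hl : s.θ.lookup l = some .nil) (hzc : GetNum zc s.τ j)
    (hij : i < j) : LabelInv s l z zc i where
  used _ := ⟨j, hzc, hij⟩
  live H M hl' := by rw [hl] at hl'; cases hl'

theorem IC.eq_counter (h : IC s.θ s.τ s.η s.κ) {zc' : Label} (hl : s.η l = some (z, zc', i))
    (hz : s.κ z = some zc) : zc' = zc :=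
  Option.some_injective _ ((h.eta_kappa l z zc' i hl).symm.trans hz)

theorem LabelInv.capture (h : IC s.θ s.τ s.η s.κ) (hrun : IsRunning s z zc i) (hl : l ∉ s.θ)
    {H : DPCtx} {K : DComp} (hH : H.labels ⊆ pdom s.η) (hK : K.labels ⊆ pdom s.η) :
    LabelInv (s.capture z zc i l H K) l z zc i where
  used hnil := by cases hnil.symm.trans (Finmap.lookup_insert _)
  live H' K' hfull := by
    have hsub := (LocalUpdate.capture h hrun.kappa hl i H K).env
    cases hfull.symm.trans (Finmap.lookup_insert _)
    refine ⟨fun hlK => hl (h.eta_dom.subset (hK hlK)),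
      hrun.count.insert (h.counterMap.ne hrun.kappa hrun.kappa) _, fun l' _ hne zc' j hl' => ?_,
      _, _, TrPCtx.mono ⟨hH, rfl⟩ hsub, TrComp.mono ⟨hK, rfl⟩ hsub, Finmap.lookup_insert _⟩
    rw [s.capture_eta_of_ne z zc i hne H K] at hl'
    exact (Finmap.lookup_insert_of_ne _ hne).trans
      (hrun.used l' j (h.eq_counter hl' hrun.kappa ▸ hl'))

theorem IC.labelInv_capture (h : IC s.θ s.τ s.η s.κ) (hrun : IsRunning s z zc i) (hl : l ∉ s.θ)
    {H : DPCtx} {K : DComp} (hH : H.labels ⊆ pdom s.η) (hK : K.labels ⊆ pdom s.η)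
    {l' zc' : Label} {j : ℕ} (hl' : (s.capture z zc i l H K).η l' = some (z, zc', j)) :
    zc' = zc ∧ LabelInv (s.capture z zc i l H K) l' z zc j := by
  by_cases hne : l' = l
  · subst hne
    cases hl'.symm.trans (s.capture_eta z zc i l' H K)
    exact ⟨rfl, .capture h hrun hl hH hK⟩
  · rw [s.capture_eta_of_ne z zc i hne H K] at hl'
    obtain rfl := h.eq_counter hl' hrun.kappa
    have hnil := hrun.used l' j hl'
    obtain ⟨k, hk, hjk⟩ := (h.labelInv hl').used hnil
    exact ⟨rfl, .of_used ((Finmap.lookup_insert_of_ne _ hne).trans hnil)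
      (hk.insert (h.counterMap.ne hrun.kappa hrun.kappa) _) hjk⟩

theorem IC.eta_dom_capture (h : IC s.θ s.τ s.η s.κ) (H : DPCtx) (K : DComp) :
    pdom (s.capture z zc i l H K).η = {l' | l' ∈ (s.capture z zc i l H K).θ} := by
  simp only [State.capture, pdom_update, setOf_mem_insert, h.eta_dom]

theorem IsRunning.consume (h : IC s.θ s.τ s.η s.κ) (hl : s.η l = some (z, zc, i))
    {H : DPCtx} {K : DComp} (hlive : s.θ.lookup l = some (.full ⟨H, K⟩)) :
    IsRunning (s.consume z zc i l) z zc (i + 1) where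
  kappa := h.eta_kappa l z zc i hl
  count := (GetNum.insert_self ..).insert
    (h.counterMap.ne (h.eta_kappa l z zc i hl) (h.eta_kappa l z zc i hl)) _
  lookup := Finmap.lookup_insert _
  used l' j hl' := by
    by_cases hne : l' = l
    · subst hne
      exact Finmap.lookup_insert _
    · obtain ⟨-, -, hothers, -⟩ := (h.labelInv hl).live H K hlive
      exact (Finmap.lookup_insert_of_ne _ hne).trans
        (hothers l' (h.eta_dom.subset ⟨_, hl'⟩) hne zc j hl')

theorem IC.labelInv_consume (h : IC s.θ s.τ s.η s.κ) (hl : s.η l = some (z, zc, i))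
    {H : DPCtx} {K : DComp} (hlive : s.θ.lookup l = some (.full ⟨H, K⟩))
    {l' zc' : Label} {j : ℕ} (hl' : s.η l' = some (z, zc', j)) :
    zc' = zc ∧ LabelInv (s.consume z zc i l) l' z zc j := by
  obtain rfl := h.eq_counter hl' (h.eta_kappa l z zc i hl)
  have hrun := IsRunning.consume h hl hlive
  refine ⟨rfl, .of_used (hrun.used l' j hl') hrun.count (Nat.lt_succ_of_le ?_)⟩
  obtain ⟨-, hi, hothers, -⟩ := (h.labelInv hl).live H K hlive
  by_cases hne : l' = l
  · subst hne
    cases hl.symm.trans hl'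
    exact le_rfl
  · obtain ⟨k, hk, hjk⟩ := (h.labelInv hl').used
      (hothers l' (h.eta_dom.subset ⟨_, hl'⟩) hne zc' j hl')
    exact (hk.unique hi ▸ hjk).le

theorem IC.eta_dom_consume (h : IC s.θ s.τ s.η s.κ) (hl : s.η l = some (z, zc, i)) :
    pdom s.η = {l' | l' ∈ (s.consume z zc i l).θ} :=
  h.eta_dom.trans (setOf_mem_insert_of_mem (h.eta_dom.subset ⟨_, hl⟩) _).symm

end

/-! ### Simulation of the steps -/

/-- `Focused` at a dollar term whose delimiter is already running in `AC`, as the coroutine `m`. -/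
structure FocusedRunning (s : State) (C : DCtx) (D : ACtx) (M K : DComp) (m mc : Label) (i : ℕ)
    (N L : AComp) : Prop extends Focused s C D (.dollar M K) (running m mc i N L) where
  body : Rel s.η s.κ s.θ s.τ M N
  handler : TrComp s.η K L
  isRunning : IsRunning s m mc i

section

variable {s s' : State} {C : DCtx} {D : ACtx} {M M' K : DComp} {N N' : AComp}
  {l m mc z zc : Label} {i : ℕ}

theorem FocusedRunning.notMem_active {L : AComp} (h : FocusedRunning s C D M K m mc i N L) :
    m ∉ D.active := by
  refine fun hm => Set.disjoint_left.1 h.wf.comp.disjoint_active hm ?_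
  exact (running_active m mc i N L).superset (Set.mem_insert ..)

theorem Focused.update_running (h : Focused s C D M N) (hs : LocalUpdate z zc s s')
    (hz : z ∉ D.active) (hdom : pdom s'.η = {l | l ∈ s'.θ})
    (hinv : ∀ l zc' j, s'.η l = some (z, zc', j) → zc' = zc ∧ LabelInv s' l z zc j)
    (hrun : IsRunning s' z zc i) (hτ : StoreInactive s'.τ) (hM' : M'.labels ⊆ pdom s'.η)
    (hK : K.labels ⊆ pdom s'.η) :
    FocusedRunning s' C D M' K z zc i (M'.tr s'.η) (K.tr s'.η) where
  toFocused := h.update hs hz hdom hinv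
    (.running (M'.active_tr _) (K.active_tr _) hτ hrun.lookup)
    (by simp [running_active, DComp.active_tr])
    (.running (.of_tr hM') ⟨hK, rfl⟩ hrun.kappa hrun.count hrun.lookup hrun.used)
  body := .of_tr hM'
  handler := ⟨hK, rfl⟩
  isRunning := hrun

theorem Focused.update_translate (h : Focused s C D M N) (hs : LocalUpdate z zc s s')
    (hz : z ∉ D.active) (hdom : pdom s'.η = {l | l ∈ s'.θ})
    (hinv : ∀ l zc' j, s'.η l = some (z, zc', j) → zc' = zc ∧ LabelInv s' l z zc j)
    (hτ : StoreInactive s'.τ) (hM' : M'.labels ⊆ pdom s'.η) :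
    Focused s' C D M' (M'.tr s'.η) :=
  h.update hs hz hdom hinv (.of_active_eq_empty (M'.active_tr _) hτ)
    ((M'.active_tr _).trans_subset (Set.empty_subset _)) (.of_tr hM')

theorem Focused.start_dollar (h : Focused s C D (.dollar M K) N) :
    ∃ s' m mc i N' L, s'.θ = s.θ ∧
      .conf (D.plug N) s.τ ⟶* .conf (D.plug (running m mc i N' L)) s'.τ ∧
      FocusedRunning s' C D M K m mc i N' L := by
  have hrel := h.rel
  cases hrel with
  | running hM hK hκ hc hm hl =>
    exact ⟨s, _, _, _, _, _, rfl, .refl, h, hM, hK, hκ, hc, hm, hl⟩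
  | dollar hN =>
    obtain ⟨hlab, rfl⟩ := hN
    obtain ⟨z, hz⟩ := exists_notMem s.τ
    obtain ⟨zc, hzc'⟩ := exists_notMem (s.τ.insert z .nil)
    obtain ⟨hne, hzc⟩ := not_or.1 (mt Finmap.mem_insert.2 hzc')
    have hzD : z ∉ D.active := fun hzD =>
      hz (Finmap.mem_of_lookup_eq_some (h.wf.lookup_eq_nil hzD))
    have hstore : StoreInactive s.τ := h.wf.store
    refine ⟨s.create z zc, z, zc, 0, _, _, rfl,
      ((dollarMacro_run _ _ hz hzc hne).inCtx D).to_reflTransGen,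
      h.update_running (.create h.inv hz hzc hne) hzD h.inv.eta_dom
        (fun l zc' i hl => absurd hl (h.inv.eta_ne hz l zc' i)) (.create h.inv hz hne)
        (hstore.insert_full (by simp [refCell_active])).insert_nil
        (Set.union_subset_iff.1 hlab).1 (Set.union_subset_iff.1 hlab).2⟩

theorem Focused.exists_focus :
    ∀ (E : DCtx) {s : State} {C : DCtx} {D : ACtx} {N : AComp}, Focused s C D (E.plug M) N →
      ∃ s' D' N', s'.θ = s.θ ∧ .conf (D.plug N) s.τ ⟶* .conf (D'.plug N') s'.τ ∧
        Focused s' (C.comp E) D' M N'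
  | .hole, s, C, D, N, h => ⟨s, D, N, rfl, .refl, by rwa [DCtx.comp_hole]⟩
  | .seq E K, s, C, D, _, h => by
    have hrel := h.rel
    cases hrel with | @seq _ _ N L hE hK =>
    simpa only [ACtx.plug_comp, ACtx.plug, DCtx.comp_assoc, DCtx.comp] using
      exists_focus E (h.enter (C' := .seq .hole K) (D' := .seq .hole L) (.seq .hole hK) hE)
  | .app E V, s, C, D, _, h => by
    have hrel := h.rel
    cases hrel with | @app _ _ N W hE hV =>
    simpa only [ACtx.plug_comp, ACtx.plug, DCtx.comp_assoc, DCtx.comp] using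
      exists_focus E (h.enter (C' := .app .hole V) (D' := .app .hole W) (.app .hole hV) hE)
  | .prj i E, s, C, D, _, h => by
    have hrel := h.rel
    cases hrel with | prj hE =>
    simpa only [ACtx.plug_comp, ACtx.plug, DCtx.comp_assoc, DCtx.comp] using
      exists_focus E (h.enter (C' := .prj i .hole) (D' := .prj i .hole) (.prj .hole) hE)
  | .dollar E K, s, C, D, _, h => by
    obtain ⟨s₁, m, mc, i, N, L, hθ₁, hstart, h₁⟩ := h.start_dollar
    obtain ⟨s', D', N', hθ, hrun, hfocus⟩ := exists_focus E
      (h₁.enter (C' := .dollar .hole K) (D' := .running m mc i .hole L)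
        (.running .hole h₁.handler h₁.isRunning) h₁.body)
    rw [ACtx.plug_comp] at hrun
    rw [DCtx.comp_assoc] at hfocus
    exact ⟨s', D', N', hθ.trans hθ₁, hstart.trans hrun, hfocus⟩

theorem Focused.pure_step (h : Focused s C D M N) (hM : M.Undelimited)
    (hlab : M'.labels ⊆ M.labels)
    (hrun : .conf (M.tr s.η) s.τ ⟶⁺ .conf (M'.tr s.η) s.τ) :
    ∃ c, .conf (D.plug N) s.τ ⟶⁺ c ∧ Sim (.conf (C.plug M') s.θ) c := by
  obtain ⟨hMη, rfl⟩ := h.rel.trComp hM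
  exact ⟨_, hrun.inCtx D, (h.translate (hlab.trans hMη)).sim⟩

theorem Focused.ret_step {V : DVal} (h : Focused s C D (.dollar (.ret V) K) N) :
    ∃ c, .conf (D.plug N) s.τ ⟶⁺ c ∧ Sim (.conf (C.plug (K.inst V)) s.θ) c := by
  obtain ⟨s', m, mc, i, N', L, hθ, hstart, hfocus⟩ := h.start_dollar
  obtain ⟨hV, rfl⟩ := hfocus.body.trComp trivial
  obtain ⟨hK, rfl⟩ := hfocus.handler
  have hret := (running_ret m mc i (V.tr s'.η) (K.tr s'.η) s'.τ).inCtx D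
  rw [← DComp.tr_inst] at hret
  refine ⟨_, .trans_right hstart hret, hθ ▸ (hfocus.toFocused.translate ?_).sim⟩
  exact (K.labels_inst_subset V).trans (Set.union_subset hV hK)

theorem Focused.shift_step {H : DPCtx} (h : Focused s C D (.dollar (H.plug (.shift M)) K) N)
    (hl : l ∉ s.θ) :
    ∃ c, .conf (D.plug N) s.τ ⟶⁺ c ∧
      Sim (.conf (C.plug (M.inst (.lab l))) (s.θ.insert l (.full ⟨H, K⟩))) c := by
  obtain ⟨s₁, z, zc, i, N', L, hθ, hstart, hfocus⟩ := h.start_dollar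
  rw [← hθ] at hl ⊢
  obtain ⟨hlab, rfl⟩ := hfocus.body.trComp (H.undelimited_plug trivial)
  obtain ⟨hK, rfl⟩ := hfocus.handler
  rw [H.labels_plug, Set.union_subset_iff] at hlab
  obtain ⟨hH, hM⟩ := hlab
  have hs := LocalUpdate.capture hfocus.inv hfocus.isRunning.kappa hl i H K
  have hyield := (running_yield z zc i (H.tr s₁.η) (M.tr s₁.η) (K.tr s₁.η) s₁.τ).inCtx D
  have hinst : (M.tr s₁.η).inst (triple (z, zc, i)) =
      (M.inst (.lab l)).tr (s₁.capture z zc i l H K).η := by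
    rw [DComp.tr_inst, DVal.tr_lab (s₁.capture_eta z zc i l H K),
      ← DComp.tr_congr (M := M) (hs.env.eqOn.mono hM)]
  rw [hinst] at hyield
  rw [DPCtx.tr_plug] at hstart
  have hlab' : (M.inst (.lab l)).labels ⊆ pdom (s₁.capture z zc i l H K).η :=
    (M.labels_inst_subset _).trans (Set.union_subset
      (Set.singleton_subset_iff.2 ⟨_, s₁.capture_eta z zc i l H K⟩) (hM.trans hs.env.pdom_subset))
  have hstore : StoreInactive s₁.τ := hfocus.wf.store
  exact ⟨_, .trans_right hstart hyield, (hfocus.update_translate hs hfocus.notMem_active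
    (hfocus.inv.eta_dom_capture H K)
    (fun _ _ _ => hfocus.inv.labelInv_capture hfocus.isRunning hl hH hK)
    (hstore.insert_full (captured_active_tr ..)) hlab').sim⟩

theorem Focused.throw_step {H : DPCtx} {V : DVal} (h : Focused s C D (.throw (.lab l) V) N)
    (hlive : s.θ.lookup l = some (.full ⟨H, K⟩)) :
    ∃ c, .conf (D.plug N) s.τ ⟶⁺ c ∧
      Sim (.conf (C.plug (.dollar (H.plug (.ret V)) K)) (s.θ.insert l .nil)) c := by
  obtain ⟨hlab, rfl⟩ := h.rel.trComp trivial
  obtain ⟨hlη, hV⟩ := Set.union_subset_iff.1 hlab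
  obtain ⟨⟨z, zc, i⟩, hl⟩ := hlη rfl
  have hzc := h.inv.eta_kappa l z zc i hl
  obtain ⟨-, hi, -, _, _, ⟨hH, rfl⟩, ⟨hK, rfl⟩, hz⟩ := (h.inv.labelInv hl).live H K hlive
  have hzD : z ∉ D.active := fun hzD => by cases hz.symm.trans (h.wf.lookup_eq_nil hzD)
  have hstore : StoreInactive s.τ := h.wf.store
  have hthrow := (throwMacro_run _ _ (V.tr s.η) hi (h.inv.counterMap.ne hzc hzc) hz).inCtx D
  rw [← DVal.tr_lab hl] at hthrow
  have hlab' : (H.plug (.ret V)).labels ⊆ pdom s.η := by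
    rw [DPCtx.labels_plug]
    exact Set.union_subset hH hV
  have hfocus := h.update_running (LocalUpdate.consume h.inv hl) hzD (h.inv.eta_dom_consume hl)
    (fun _ _ _ => h.inv.labelInv_consume hl hlive) (.consume h.inv hl hlive)
    (hstore.insert_full (by simp [refCell_active])).insert_nil hlab' hK
  rw [DPCtx.tr_plug] at hfocus
  exact ⟨_, hthrow, hfocus.sim⟩

theorem Focused.fail_step {V : DVal} (h : Focused s C D (.throw (.lab l) V) N)
    (hnil : s.θ.lookup l = some .nil) : .conf (D.plug N) s.τ ⟶⁺ .bot := by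
  obtain ⟨hlab, rfl⟩ := h.rel.trComp trivial
  obtain ⟨⟨z, zc, i⟩, hl⟩ := (Set.union_subset_iff.1 hlab).1 rfl
  obtain ⟨j, hj, hij⟩ := (h.inv.labelInv hl).used hnil
  have hfail := (throwMacro_fail (z := z) (V.tr s.η) hj hij.ne).inCtx D
  rwa [← DVal.tr_lab hl] at hfail

theorem Focused.beta_step {R : DConf} (h : Focused s C D M N) (hstep : DBeta M s.θ R) :
    ∃ c, .conf (D.plug N) s.τ ⟶⁺ c ∧ Sim (R.inCtx C) c := by
  cases hstep with
  | pcase V₁ V₂ M =>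
    exact h.pure_step trivial (M.labels_inst2_subset V₁ V₂) (.pcase (DComp.tr_inst2 ..).symm)
  | scase L V B M _ hB =>
    refine h.pure_step trivial ((M.labels_inst_subset V).trans
      (Set.union_subset_union_right _ (DBrs.labels_subset_of_find hB)))
      (.scase (by rw [DBrs.find_tr, hB]; rfl) (DComp.tr_inst ..).symm)
  | force M => exact h.pure_step trivial le_rfl (ABeta.force _ _).plus
  | seq V M =>
    exact h.pure_step trivial (M.labels_inst_subset V)
      (by rw [DComp.tr_inst]; exact (ABeta.seq _ _ _).plus)
  | app M V =>
    exact h.pure_step trivial ((M.labels_inst_subset V).trans (Set.union_comm ..).le)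
      (by rw [DComp.tr_inst]; exact (ABeta.app _ _ _).plus)
  | prj₁ M M' => exact h.pure_step trivial Set.subset_union_left (ABeta.prj₁ _ _ _).plus
  | prj₂ M M' => exact h.pure_step trivial Set.subset_union_right (ABeta.prj₂ _ _ _).plus
  | ret V K => exact h.ret_step
  | shift H M K _ l hl => exact h.shift_step hl
  | throw l V H K _ hlive => exact h.throw_step hlive
  | fail l V _ hnil => exact ⟨.bot, h.fail_step hnil, .inl ⟨rfl, rfl⟩⟩

end

end DelToAC

theorem mainTheorem1 (C : DCtx) (M : DComp) (θ : DStore) (D : AConf) (R : DConf)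
    (hsim : Sim (DConf.conf (C.plug M) θ) D) (hstep : DBeta M θ R) :
    ∃ D' : AConf, Relation.TransGen AStep D D' ∧ Sim (R.inCtx C) D' := by
  obtain ⟨⟨⟩, -⟩ | ⟨_, N, _, τ, η, κ, ⟨⟩, rfl, hrel, hwf, hinv⟩ := hsim
  have hfocus : Focused ⟨η, κ, θ, τ⟩ .hole .hole (C.plug M) N := ⟨.hole, hrel, hwf, hinv⟩
  obtain ⟨s, D, N', rfl, hrun, hfocus⟩ := hfocus.exists_focus C
  obtain ⟨D', hstep, hsim⟩ := hfocus.beta_step hstep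
  exact ⟨D', .trans_right hrun hstep, hsim⟩
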